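/- Let $A>0$, $\gamma>1$, $\tau_\Pi>0$, $\zeta>0$, $\bar\rho>0$ and $R>0$ be constants, let $P(\rho)=A\rho^\gamma$ and $c_s(\rho)=\sqrt{P'(\rho)}$, and let the shear viscosity $\eta=\eta(\rho,\Pi_{ij})$ be any $C^1$ function of the density $\rho>0$ and the stress tensor with $\bar\eta:=\eta(\bar\rho,0)>0$. For a density $\rho>0$, a velocity field $\mathbf v$ and a symmetric viscous stress tensor $\Pi_{ij}$ on $[0,T]\times\mathbb R^3$ consider the system $$\frac1\rho\partial_t\rho+\partial_kv^k+\frac1\rho v^k\partial_k\rho=0,$$ $$\frac{\rho}{c_s^2}\partial_tv_i+\partial_i\rho+\frac{\rho}{c_s^2}(v^k\partial_k)v_i+\frac1{c_s^2}\partial_j\Pi_i^j=0,$$ $$\tau_\Pi\partial_t\Pi_{ij}+\eta\,\partial_iv_j+\eta\,\partial_jv_i+\delta_{ij}\Big(\zeta-\frac{2\eta}3\Big)\partial_kv^k+\tau_\Pi\partial_k(v^k\Pi_{ij})+\Pi_{ij}=0,$$ where $c_s=c_s(\rho)$ and $\eta=\eta(\rho,\Pi_{ij})$. Put $$\bar c_v=\sqrt{c_s(\bar\rho)^2+\frac{\zeta+\frac43\bar\eta}{\bar\rho\,\tau_\Pi}},$$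 the largest characteristic speed of the system at the state $(\bar\rho,0,0)$. Suppose that $(\rho,\mathbf v,\Pi_{ij})$ is a $C^1$ solution on $[0,T]\times\mathbb R^3$ for some $T>0$, with initial data $(\rho^0,\mathbf v^0,\Pi^0_{ij})$ such that $\rho^0(\mathbf x)=\bar\rho$, $\mathbf v^0(\mathbf x)=0$ and $\Pi^0_{ij}(\mathbf x)=0$ for $|\mathbf x|\ge R$. Suppose further that $$\Delta M(0)=\int_{\mathbb R^3}(\rho^0-\bar\rho)\,d^3\mathbf x\ge0,\qquad G(0)=\int_{\mathbb R^3}(\Pi^0)^i_i\,d^3\mathbf x\ge0,$$ $$F(0)=\int_{\mathbb R^3}x_i\,\rho^0\,(v^0)^i\,d^3\mathbf x>\frac{16\pi}3\,\bar c_v\,R^4\max_{\mathbf x}\rho^0(\mathbf x).$$ Then the lifespan of $(\rho,\mathbf v,\Pi_{ij})$ is finite, that is, the supremum of all $\mathcal T>0$ such that the system has a $C^1$ solution on $[0,\mathcal T]\times\mathbb R^3$ with the initial data $(\rho^0,\mathbf v^0,\Pi^0_{ij})$ is finite. -/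

import Mathlib

open MeasureTheory Set
open scoped ENNReal

noncomputable section

namespace ShearBulkFluid

/-- Physical space `ℝ³` with its Euclidean norm. -/
abbrev Space : Type := EuclideanSpace ℝ (Fin 3)

/-- Components `Π_{ij}` of a second-order tensor on `ℝ³`. -/
abbrev Tensor : Type := Fin 3 → Fin 3 → ℝ

/-- The spatial partial derivative `∂ₖ f (x)`. -/
def partialDeriv (k : Fin 3) (f : Space → ℝ) (x : Space) : ℝ :=
  fderiv ℝ f x (EuclideanSpace.single k 1)

/-- The time derivative `∂ₜ f (t, x)` of a field on `[0, T] × ℝ³` (one-sided at `t = 0` and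
`t = T`). -/
def timeDeriv (T : ℝ) (f : ℝ → Space → ℝ) (t : ℝ) (x : Space) : ℝ :=
  derivWithin (fun s => f s x) (Icc 0 T) t

/-- The divergence `∂ₖ wᵏ`. -/
def divergence (w : Space → Space) (x : Space) : ℝ :=
  ∑ k, partialDeriv k (fun y => w y k) x

/-- The polytropic equation of state `P(ρ) = A ρ^γ`. -/
def pressure (A γ : ℝ) (r : ℝ) : ℝ := A * r ^ γ

/-- The speed of sound `c_s = √(∂P/∂ρ)`. -/
def soundSpeed (A γ : ℝ) (r : ℝ) : ℝ := √(deriv (pressure A γ) r)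

/-- `(ρ, v, Π)` is a classical (`C¹`) solution on `[0, T] × ℝ³`, with positive density and
symmetric viscous stress tensor `Π = S`, of the equations of a compressible barotropic fluid
whose viscous stress tensor relaxes to its Navier-Stokes value. The relaxation time `τ` and the
bulk viscosity `ζ` are constants; the shear viscosity `η` is a function of the density and of the
stress tensor. -/
structure IsC1Solution (A γ τ ζ : ℝ) (η : ℝ → Tensor → ℝ) (T : ℝ)
    (ρ : ℝ → Space → ℝ) (v : ℝ → Space → Space) (S : ℝ → Space → Tensor) : Prop where
  contDiffOn_density : ContDiffOn ℝ 1 (fun p : ℝ × Space => ρ p.1 p.2) (Icc 0 T ×ˢ univ)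
  contDiffOn_velocity : ContDiffOn ℝ 1 (fun p : ℝ × Space => v p.1 p.2) (Icc 0 T ×ˢ univ)
  contDiffOn_stress : ContDiffOn ℝ 1 (fun p : ℝ × Space => S p.1 p.2) (Icc 0 T ×ˢ univ)
  density_pos : ∀ t ∈ Icc 0 T, ∀ x, 0 < ρ t x
  stress_symm : ∀ t ∈ Icc 0 T, ∀ x i j, S t x i j = S t x j i
  /-- Conservation of mass. -/
  mass : ∀ t ∈ Icc 0 T, ∀ x,
    1 / ρ t x * timeDeriv T ρ t x + divergence (v t) x
      + 1 / ρ t x * ∑ k, v t x k * partialDeriv k (ρ t) x = 0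
  /-- Balance of momentum. -/
  momentum : ∀ t ∈ Icc 0 T, ∀ x, ∀ i,
    ρ t x / soundSpeed A γ (ρ t x) ^ 2 * timeDeriv T (fun s y => v s y i) t x
      + partialDeriv i (ρ t) x
      + ρ t x / soundSpeed A γ (ρ t x) ^ 2
          * ∑ k, v t x k * partialDeriv k (fun y => v t y i) x
      + 1 / soundSpeed A γ (ρ t x) ^ 2
          * ∑ j, partialDeriv j (fun y => S t y i j) x = 0
  /-- Relaxation of the viscous stress tensor. -/
  relaxation : ∀ t ∈ Icc 0 T, ∀ x, ∀ i j,
    τ * timeDeriv T (fun s y => S s y i j) t x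
      + η (ρ t x) (S t x) * partialDeriv i (fun y => v t y j) x
      + η (ρ t x) (S t x) * partialDeriv j (fun y => v t y i) x
      + (if i = j then 1 else 0) * (ζ - 2 * η (ρ t x) (S t x) / 3) * divergence (v t) x
      + τ * ∑ k, partialDeriv k (fun y => v t y k * S t y i j) x
      + S t x i j = 0

/-- The lifespan, in `[0, ∞]`, of `C¹` solutions with initial data `(ρ₀, v₀, S₀)`: the supremum
of all `T > 0` such that there is a `C¹` solution on `[0, T]` with these data. -/
def lifespan (A γ τ ζ : ℝ) (η : ℝ → Tensor → ℝ)
    (ρ₀ : Space → ℝ) (v₀ : Space → Space) (S₀ : Space → Tensor) : ℝ≥0∞ :=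
  sSup {L : ℝ≥0∞ | ∃ T : ℝ, 0 < T ∧ L = ENNReal.ofReal T ∧
    ∃ (ρ : ℝ → Space → ℝ) (v : ℝ → Space → Space) (S : ℝ → Space → Tensor),
      IsC1Solution A γ τ ζ η T ρ v S ∧ ρ 0 = ρ₀ ∧ v 0 = v₀ ∧ S 0 = S₀}

/-- The speed `c̄_v = √(c̄_s² + (ζ + 4η̄/3) / (ρ̄ τ))` of propagation of the front of a disturbance
of the equilibrium state `(ρ̄, 0, 0)`, with `η̄` the shear viscosity of that state: the largest
characteristic speed there. -/
def frontSpeed (A γ τ ζ : ℝ) (η : ℝ → Tensor → ℝ) (ρbar : ℝ) : ℝ :=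
  √(soundSpeed A γ ρbar ^ 2 + (ζ + 4 / 3 * η ρbar 0) / (ρbar * τ))

/-- The relative mass `ΔM = ∫ (ρ - ρ̄)`. -/
def relativeMass (ρbar : ℝ) (r : Space → ℝ) : ℝ := ∫ x, (r x - ρbar)

/-- The radial momentum `F = ∫ x_i ρ v^i`. -/
def radialMomentum (r : Space → ℝ) (w : Space → Space) : ℝ := ∫ x, ∑ i, x i * r x * w x i

/-- The integrated trace `G = ∫ Π^i_i` of the viscous stress tensor. -/
def totalTrace (s : Space → Tensor) : ℝ := ∫ x, ∑ i, s x i i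

end ShearBulkFluid

end

/-!
The proof follows Sideris' blow-up argument: a disturbance of the equilibrium spreads with finite
speed, while its radial momentum grows too fast to fit into the region it can reach.

**Finite speed of propagation.** Let `(r, v, Π)` be the deviation of a solution from `(ρ̄, 0, 0)`.
Since the equilibrium is constant, replacing the coefficients of the equations by their values at
equilibrium costs an error which is a product of the deviation with a derivative of the solution.
On a compact set this error is of order zero, so no a priori bound at infinity and no smallness is
needed, and the solution obeys the linearized system up to harmless terms. That system has the
energy density `linEnergy`, and the heart of the matter is the sharp estimate `linFlux_le` of its
flux by `c̄_v` times the energy, which rests on `traceFree_apply_bound` for trace-free symmetric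
matrices. Multiplying with a smooth cutoff function of a backward cone of slope `c̄_v`, Grönwall's
inequality gives `IsC1Solution.integral_energy_cone_nonpos`; hence the solution is at equilibrium
for `|x| ≥ R + c̄_v t` (`IsC1Solution.eq_equilibrium_of_le_norm`).

**Virial inequality.** By the compact support, the relative mass `ΔM` is conserved, the integrated
trace `G` of the stress satisfies `G' = -G / τ` and so stays nonnegative, and the radial momentum
satisfies `F' = ∫ (ρ|v|² + 3 (P - P̄) + tr Π)`. Convexity of `P` bounds the pressure term from below
by a multiple of `ΔM ≥ 0`, and the Cauchy-Schwarz inequality turns the rest into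
`F' ≥ F² / (κ (R + c̄_v t)⁵)` with `κ = 4π/3 max ρ⁰`. As `∫₀^∞ (R + c̄_v t)⁻⁵ dt = 1 / (4 c̄_v R⁴)`,
the function `F` cannot exist for all times if `F(0) > 4 κ c̄_v R⁴` (`time_le_of_riccati`), which is
the assumption on the initial data. The resulting bound for the time of existence depends on the
data only, and therefore bounds the lifespan.
-/

namespace ShearBulkFluid

open Filter Topology

/-! ### Fields of class `C¹` on a slab of space-time -/

/-- The scalar field `u` is of class `C¹` on `[0, T] × ℝ³`, up to the boundary times. -/
abbrev C1Slab (T : ℝ) (u : ℝ → Space → ℝ) : Prop :=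
  ContDiffOn ℝ 1 (fun p : ℝ × Space => u p.1 p.2) (Icc 0 T ×ˢ univ)

lemma slab_mem_nhds {T t : ℝ} (ht : t ∈ Ioo 0 T) (x : Space) :
    Icc 0 T ×ˢ (univ : Set Space) ∈ 𝓝 (t, x) :=
  prod_mem_nhds (Icc_mem_nhds ht.1 ht.2) univ_mem

lemma slab_mem {T t : ℝ} (ht : t ∈ Icc 0 T) (x : Space) :
    (t, x) ∈ Icc 0 T ×ˢ (univ : Set Space) := ⟨ht, mem_univ x⟩

lemma uniqueDiffOn_slab {T : ℝ} (hT : 0 < T) :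
    UniqueDiffOn ℝ (Icc 0 T ×ˢ (univ : Set Space)) :=
  (uniqueDiffOn_Icc hT).prod uniqueDiffOn_univ

section Slab

variable {T : ℝ} {u : ℝ → Space → ℝ}

lemma C1Slab.continuousOn (hu : C1Slab T u) :
    ContinuousOn (Function.uncurry u) (Icc 0 T ×ˢ univ) :=
  ContDiffOn.continuousOn hu

lemma C1Slab.contDiff_slice (hu : C1Slab T u) {t : ℝ} (ht : t ∈ Icc 0 T) :
    ContDiff ℝ 1 (u t) := by
  rw [← contDiffOn_univ]
  exact ContDiffOn.comp hu (f := fun x : Space => (t, x)) (by fun_prop) fun x _ => slab_mem ht x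

lemma C1Slab.continuous_slice (hu : C1Slab T u) {t : ℝ} (ht : t ∈ Icc 0 T) :
    Continuous (u t) := (hu.contDiff_slice ht).continuous

lemma C1Slab.differentiableAt_slice (hu : C1Slab T u) {t : ℝ} (ht : t ∈ Icc 0 T) (x : Space) :
    DifferentiableAt ℝ (u t) x := (hu.contDiff_slice ht).differentiable one_ne_zero x

lemma C1Slab.continuousOn_time (hu : C1Slab T u) (x : Space) :
    ContinuousOn (fun t => u t x) (Icc 0 T) :=
  hu.continuousOn.comp (f := fun t : ℝ => (t, x)) (by fun_prop) fun _ ht => slab_mem ht x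

lemma C1Slab.hasFDerivAt (hu : C1Slab T u) {t : ℝ} (ht : t ∈ Ioo 0 T) (x : Space) :
    HasFDerivAt (fun p : ℝ × Space => u p.1 p.2)
      (fderivWithin ℝ (fun p : ℝ × Space => u p.1 p.2) (Icc 0 T ×ˢ univ) (t, x)) (t, x) :=
  ((ContDiffOn.differentiableOn hu one_ne_zero) _
    (slab_mem (Ioo_subset_Icc_self ht) x)).hasFDerivWithinAt.hasFDerivAt (slab_mem_nhds ht x)

lemma timeDeriv_eq_deriv {t : ℝ} (ht : t ∈ Ioo 0 T) (x : Space) :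
    timeDeriv T u t x = deriv (fun s => u s x) t :=
  derivWithin_of_mem_nhds (Icc_mem_nhds ht.1 ht.2)

lemma C1Slab.hasDerivAt_fderivWithin (hu : C1Slab T u) {t : ℝ} (ht : t ∈ Ioo 0 T) (x : Space) :
    HasDerivAt (fun s => u s x)
      (fderivWithin ℝ (fun p : ℝ × Space => u p.1 p.2) (Icc 0 T ×ˢ univ) (t, x) (1, 0)) t :=
  (hu.hasFDerivAt ht x).comp_hasDerivAt (f := fun s : ℝ => (s, x)) t
    ((hasDerivAt_id t).prodMk (hasDerivAt_const t x))

lemma C1Slab.timeDeriv_eq_fderivWithin (hu : C1Slab T u) {t : ℝ} (ht : t ∈ Ioo 0 T) (x : Space) :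
    timeDeriv T u t x =
      fderivWithin ℝ (fun p : ℝ × Space => u p.1 p.2) (Icc 0 T ×ˢ univ) (t, x) (1, 0) := by
  rw [timeDeriv_eq_deriv ht, (hu.hasDerivAt_fderivWithin ht x).deriv]

lemma C1Slab.hasDerivAt_time (hu : C1Slab T u) {t : ℝ} (ht : t ∈ Ioo 0 T) (x : Space) :
    HasDerivAt (fun s => u s x) (timeDeriv T u t x) t := by
  rw [hu.timeDeriv_eq_fderivWithin ht]
  exact hu.hasDerivAt_fderivWithin ht x

lemma C1Slab.partialDeriv_eq_fderivWithin (hu : C1Slab T u) {t : ℝ} (ht : t ∈ Ioo 0 T)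
    (k : Fin 3) (x : Space) :
    partialDeriv k (u t) x =
      fderivWithin ℝ (fun p : ℝ × Space => u p.1 p.2) (Icc 0 T ×ˢ univ) (t, x)
        (0, EuclideanSpace.single k 1) := by
  have h : HasFDerivAt (u t) _ x :=
    (hu.hasFDerivAt ht x).comp (f := fun y : Space => (t, y)) x
      ((hasFDerivAt_const t x).prodMk (hasFDerivAt_id x))
  rw [partialDeriv, h.fderiv]
  simp

/-- First derivatives of a `C¹` field are bounded on compact sets, uniformly in time. -/
lemma C1Slab.exists_deriv_bound (hu : C1Slab T u) (hT : 0 < T) {K : Set Space}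
    (hK : IsCompact K) :
    ∃ D, 0 ≤ D ∧ ∀ t ∈ Ioo 0 T, ∀ x ∈ K,
      |timeDeriv T u t x| ≤ D ∧ ∀ k, |partialDeriv k (u t) x| ≤ D := by
  obtain ⟨D, hD⟩ := (isCompact_Icc.prod hK).exists_bound_of_continuousOn
    ((ContDiffOn.continuousOn_fderivWithin hu (uniqueDiffOn_slab hT) le_rfl).mono
      (prod_mono_right (subset_univ K)))
  refine ⟨max D 0, le_max_right _ _, fun t ht x hx => ?_⟩
  have hb := (hD (t, x) ⟨Ioo_subset_Icc_self ht, hx⟩).trans (le_max_left D 0)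
  rw [hu.timeDeriv_eq_fderivWithin ht]
  refine ⟨?_, fun k => ?_⟩
  · exact (ContinuousLinearMap.le_of_opNorm_le _ hb _).trans_eq (by simp)
  · rw [hu.partialDeriv_eq_fderivWithin ht]
    exact (ContinuousLinearMap.le_of_opNorm_le _ hb _).trans_eq (by simp)

lemma C1Slab.exists_bound (hu : C1Slab T u) {K : Set Space} (hK : IsCompact K) :
    ∃ D, 0 ≤ D ∧ ∀ t ∈ Icc 0 T, ∀ x ∈ K, |u t x| ≤ D := by
  obtain ⟨D, hD⟩ := (isCompact_Icc.prod hK).exists_bound_of_continuousOn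
    (hu.continuousOn.mono (prod_mono_right (subset_univ K)))
  exact ⟨max D 0, le_max_right _ _, fun t ht x hx =>
    (hD (t, x) ⟨ht, hx⟩).trans (le_max_left D 0)⟩

lemma C1Slab.continuous_timeDeriv (hu : C1Slab T u) {t : ℝ} (ht : t ∈ Ioo 0 T) :
    Continuous (timeDeriv T u t) := by
  have hT : 0 < T := ht.1.trans ht.2
  rw [show timeDeriv T u t = _ from funext (hu.timeDeriv_eq_fderivWithin ht)]
  refine Continuous.clm_apply ?_ continuous_const
  rw [← continuousOn_univ]
  exact (ContDiffOn.continuousOn_fderivWithin hu (uniqueDiffOn_slab hT) le_rfl).comp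
    (f := fun x : Space => (t, x)) (by fun_prop) fun x _ => slab_mem (Ioo_subset_Icc_self ht) x

lemma timeDeriv_eq_zero_of_notMem {K : Set Space} (h0 : ∀ t ∈ Icc 0 T, ∀ x ∉ K, u t x = 0)
    {t : ℝ} (ht : t ∈ Ioo 0 T) {x : Space} (hx : x ∉ K) : timeDeriv T u t x = 0 := by
  rw [timeDeriv_eq_deriv ht]
  refine ((hasDerivAt_const t (0 : ℝ)).congr_of_eventuallyEq ?_).deriv
  filter_upwards [Icc_mem_nhds ht.1 ht.2] with s hs using h0 s hs x hx

end Slab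

/-! ### Integrals over space of balance laws -/

/-- A function vanishing off a compact set has compact support. -/
lemma hasCompactSupport_of_notMem {w : Space → ℝ} {K : Set Space} (hK : IsCompact K)
    (h0 : ∀ x ∉ K, w x = 0) : HasCompactSupport w :=
  HasCompactSupport.intro hK h0

lemma integral_partialDeriv_eq_zero {w : Space → ℝ} (hw : ContDiff ℝ 1 w)
    (hc : HasCompactSupport w) (k : Fin 3) : ∫ x, partialDeriv k w x = 0 := by
  have hcont : Continuous fun x => fderiv ℝ w x (EuclideanSpace.single k 1) :=
    (hw.continuous_fderiv one_ne_zero).clm_apply continuous_const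
  have hcs : HasCompactSupport fun x => fderiv ℝ w x (EuclideanSpace.single k 1) :=
    hc.fderiv_apply ℝ _
  have := integral_mul_fderiv_eq_neg_fderiv_mul_of_integrable (μ := (volume : Measure Space))
    (f := fun _ => (1 : ℝ)) (g := w) (v := EuclideanSpace.single k 1)
    (by simp) (by simpa using hcont.integrable_of_hasCompactSupport hcs)
    (by simpa using hw.continuous.integrable_of_hasCompactSupport hc)
    (fun x _ => by fun_prop) (fun x _ => hw.differentiable one_ne_zero x)
  simpa [partialDeriv] using this

section Balance

variable {T : ℝ} {u : ℝ → Space → ℝ} {K : Set Space}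

lemma C1Slab.continuousOn_integral (hu : C1Slab T u) (hK : IsCompact K)
    (h0 : ∀ t ∈ Icc 0 T, ∀ x ∉ K, u t x = 0) :
    ContinuousOn (fun t => ∫ x, u t x) (Icc 0 T) :=
  continuousOn_integral_of_compact_support hK hu.continuousOn fun t x ht hx => h0 t ht x hx

lemma C1Slab.integrable_slice (hu : C1Slab T u) (hK : IsCompact K)
    (h0 : ∀ t ∈ Icc 0 T, ∀ x ∉ K, u t x = 0) {t : ℝ} (ht : t ∈ Icc 0 T) : Integrable (u t) :=
  (hu.continuous_slice ht).integrable_of_hasCompactSupport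
    (hasCompactSupport_of_notMem hK (h0 t ht))

lemma C1Slab.hasDerivAt_integral (hu : C1Slab T u) (hK : IsCompact K)
    (h0 : ∀ t ∈ Icc 0 T, ∀ x ∉ K, u t x = 0) {t : ℝ} (ht : t ∈ Ioo 0 T) :
    HasDerivAt (fun s => ∫ x, u s x) (∫ x, timeDeriv T u t x) t := by
  obtain ⟨D, hD0, hD⟩ := hu.exists_deriv_bound (ht.1.trans ht.2) hK
  refine (hasDerivAt_integral_of_dominated_loc_of_deriv_le (s := Ioo 0 T)
    (F := u) (F' := timeDeriv T u) (bound := K.indicator fun _ => D)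
    (Ioo_mem_nhds ht.1 ht.2) ?_ (hu.integrable_slice hK h0 (Ioo_subset_Icc_self ht))
    (hu.continuous_timeDeriv ht).aestronglyMeasurable ?_ ?_ ?_).2
  · filter_upwards [Icc_mem_nhds ht.1 ht.2] with s hs
    exact (hu.continuous_slice hs).aestronglyMeasurable
  · refine ae_of_all _ fun x s hs => ?_
    by_cases hx : x ∈ K
    · rw [indicator_of_mem hx]; exact (hD s hs x hx).1
    · rw [indicator_of_notMem hx, timeDeriv_eq_zero_of_notMem h0 hs hx, norm_zero]
  · exact (integrable_indicator_iff hK.measurableSet).2 (integrableOn_const hK.measure_ne_top)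
  · exact ae_of_all _ fun x s hs => hu.hasDerivAt_time hs x

/-- If `∂ₜ u + ∂ₖ hᵏ = s` with `u` and `h` of class `C¹` and supported in a fixed compact set,
then `∫ u` has time derivative `∫ s`. -/
lemma C1Slab.hasDerivAt_integral_of_balance (hu : C1Slab T u) (hK : IsCompact K)
    (h0 : ∀ t ∈ Icc 0 T, ∀ x ∉ K, u t x = 0) {t : ℝ} (ht : t ∈ Ioo 0 T)
    {h : Fin 3 → Space → ℝ} (hh : ∀ k, ContDiff ℝ 1 (h k)) (hh0 : ∀ k, ∀ x ∉ K, h k x = 0)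
    {s : Space → ℝ} (hs : ∀ x, timeDeriv T u t x + ∑ k, partialDeriv k (h k) x = s x) :
    Integrable s ∧ HasDerivAt (fun s => ∫ x, u s x) (∫ x, s x) t := by
  have hcs k : HasCompactSupport (h k) := hasCompactSupport_of_notMem hK (hh0 k)
  have hi1 : Integrable (timeDeriv T u t) :=
    (hu.continuous_timeDeriv ht).integrable_of_hasCompactSupport
      (hasCompactSupport_of_notMem hK fun x hx => timeDeriv_eq_zero_of_notMem h0 ht hx)
  have hi2 k : Integrable (partialDeriv k (h k)) :=
    (((hh k).continuous_fderiv one_ne_zero).clm_apply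
      continuous_const).integrable_of_hasCompactSupport ((hcs k).fderiv_apply ℝ _)
  have hi3 : Integrable fun x => ∑ k, partialDeriv k (h k) x :=
    integrable_finsetSum _ fun k _ => hi2 k
  rw [← funext hs]
  refine ⟨hi1.add hi3, ?_⟩
  rw [integral_add hi1 hi3, integral_finsetSum _ fun k _ => hi2 k]
  simpa [integral_partialDeriv_eq_zero (hh _) (hcs _)] using hu.hasDerivAt_integral hK h0 ht

end Balance

/-! ### Rules for partial derivatives -/

section Rules

variable {k : Fin 3} {f g : Space → ℝ} {x : Space}

lemma partialDeriv_add (hf : DifferentiableAt ℝ f x) (hg : DifferentiableAt ℝ g x) :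
    partialDeriv k (fun y => f y + g y) x = partialDeriv k f x + partialDeriv k g x := by
  simp [partialDeriv, fderiv_fun_add hf hg]

lemma partialDeriv_mul (hf : DifferentiableAt ℝ f x) (hg : DifferentiableAt ℝ g x) :
    partialDeriv k (fun y => f y * g y) x =
      f x * partialDeriv k g x + g x * partialDeriv k f x := by
  simp [partialDeriv, fderiv_fun_mul hf hg]

lemma partialDeriv_sum {ι : Type*} {s : Finset ι} {F : ι → Space → ℝ}
    (hF : ∀ i ∈ s, DifferentiableAt ℝ (F i) x) :
    partialDeriv k (fun y => ∑ i ∈ s, F i y) x = ∑ i ∈ s, partialDeriv k (F i) x := by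
  simp [partialDeriv, fderiv_fun_sum hF]

lemma partialDeriv_const (c : ℝ) : partialDeriv k (fun _ => c) x = 0 := by
  simp [partialDeriv]

lemma partialDeriv_coord (i : Fin 3) :
    partialDeriv k (fun y => y i) x = if i = k then 1 else 0 := by
  have h : HasFDerivAt (fun y : Space => y i) (EuclideanSpace.proj i : Space →L[ℝ] ℝ) x :=
    (EuclideanSpace.proj i : Space →L[ℝ] ℝ).hasFDerivAt
  rw [partialDeriv, h.fderiv]
  simp

lemma partialDeriv_comp {φ : ℝ → ℝ} {φ' : ℝ} (hφ : HasDerivAt φ φ' (f x))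
    (hf : DifferentiableAt ℝ f x) :
    partialDeriv k (fun y => φ (f y)) x = φ' * partialDeriv k f x := by
  have h : HasFDerivAt (fun y => φ (f y)) (φ' • fderiv ℝ f x) x :=
    hφ.comp_hasFDerivAt x hf.hasFDerivAt
  simp [partialDeriv, h.fderiv]

end Rules

/-! ### The quadratic energy of the linearized system -/

/-- The quadratic energy density of the system linearized at the equilibrium `(ρ̄, 0, 0)`, for a
perturbation `(r, w, P)` of density, velocity and stress. The constant `c2` is `c_s(ρ̄)²`. The
stress enters through its trace and the square norm `|P|² - (tr P)² / 3` of its trace-free part,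
with the weights that make the linearized system symmetric. -/
noncomputable def linEnergy (c2 ρbar ηbar τ ζ r : ℝ) (w : Fin 3 → ℝ) (P : Tensor) : ℝ :=
  (c2 / ρbar * r ^ 2 + ρbar * ∑ i, w i ^ 2
    + τ / (2 * ηbar) * (∑ i, ∑ j, P i j ^ 2 - (∑ i, P i i) ^ 2 / 3)
    + τ / (9 * ζ) * (∑ i, P i i) ^ 2) / 2

/-- The flux of `linEnergy`. -/
def linFlux (c2 r : ℝ) (w : Fin 3 → ℝ) (P : Tensor) (k : Fin 3) : ℝ :=
  c2 * r * w k + ∑ i, P i k * w i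

/-- The squared length `r² + |w|² + |P|²` of a perturbation. -/
def sqSize (r : ℝ) (w : Fin 3 → ℝ) (P : Tensor) : ℝ :=
  r ^ 2 + ∑ i, w i ^ 2 + ∑ i, ∑ j, P i j ^ 2

lemma traceFree_normSq_nonneg (P : Tensor) :
    0 ≤ ∑ i, ∑ j, P i j ^ 2 - (∑ i, P i i) ^ 2 / 3 := by
  simp only [Fin.sum_univ_three]
  nlinarith [sq_nonneg (P 0 0 - P 1 1), sq_nonneg (P 1 1 - P 2 2), sq_nonneg (P 0 0 - P 2 2),
    sq_nonneg (P 0 1), sq_nonneg (P 0 2), sq_nonneg (P 1 0), sq_nonneg (P 1 2), sq_nonneg (P 2 0),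
    sq_nonneg (P 2 1)]

lemma linEnergy_nonneg {c2 ρbar ηbar τ ζ : ℝ} (hc : 0 < c2) (hρ : 0 < ρbar) (hη : 0 < ηbar)
    (hτ : 0 < τ) (hζ : 0 < ζ) (r : ℝ) (w : Fin 3 → ℝ) (P : Tensor) :
    0 ≤ linEnergy c2 ρbar ηbar τ ζ r w P := by
  have := traceFree_normSq_nonneg P
  unfold linEnergy
  positivity

/-- The linearized energy is coercive. -/
lemma exists_sqSize_le {c2 ρbar ηbar τ ζ : ℝ} (hc : 0 < c2) (hρ : 0 < ρbar) (hη : 0 < ηbar)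
    (hτ : 0 < τ) (hζ : 0 < ζ) :
    ∃ C, 0 ≤ C ∧ ∀ r w P, sqSize r w P ≤ C * linEnergy c2 ρbar ηbar τ ζ r w P := by
  set a := c2 / ρbar with ha
  set b := τ / (2 * ηbar) with hb
  set d := τ / (9 * ζ) with hd
  have ha0 : 0 < a := by positivity
  have hb0 : 0 < b := by positivity
  have hd0 : 0 < d := by positivity
  refine ⟨2 * (1 / a + 1 / ρbar + 1 / b + 1 / (3 * d)), by positivity, fun r w P => ?_⟩
  have hs := traceFree_normSq_nonneg P
  unfold linEnergy sqSize
  rw [← ha, ← hb, ← hd]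
  set s := ∑ i, ∑ j, P i j ^ 2 - (∑ i, P i i) ^ 2 / 3 with hsdef
  have hP : ∑ i, ∑ j, P i j ^ 2 = s + (∑ i, P i i) ^ 2 / 3 := by rw [hsdef]; ring
  rw [hP]
  set q := (∑ i, P i i) ^ 2
  set n := ∑ i, w i ^ 2
  have hq : 0 ≤ q := sq_nonneg _
  have hn : 0 ≤ n := Finset.sum_nonneg fun i _ => sq_nonneg _
  set E := a * r ^ 2 + ρbar * n + b * s + d * q with hE
  have h1 : a * r ^ 2 ≤ E := by rw [hE]; have : 0 ≤ ρbar * n + b * s + d * q := by positivity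
                                linarith
  have h2 : ρbar * n ≤ E := by rw [hE]; have : 0 ≤ a * r ^ 2 + b * s + d * q := by positivity
                               linarith
  have h3 : b * s ≤ E := by rw [hE]; have : 0 ≤ a * r ^ 2 + ρbar * n + d * q := by positivity
                            linarith
  have h4 : d * q ≤ E := by rw [hE]; have : 0 ≤ a * r ^ 2 + ρbar * n + b * s := by positivity
                            linarith
  have e1 : r ^ 2 ≤ 1 / a * E := by rw [div_mul_eq_mul_div, le_div_iff₀ ha0]; linarith
  have e2 : n ≤ 1 / ρbar * E := by rw [div_mul_eq_mul_div, le_div_iff₀ hρ]; linarith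
  have e3 : s ≤ 1 / b * E := by rw [div_mul_eq_mul_div, le_div_iff₀ hb0]; linarith
  have e4 : q / 3 ≤ 1 / (3 * d) * E := by
    rw [div_mul_eq_mul_div, le_div_iff₀ (by positivity)]; linarith
  linarith

lemma sqSize_eq_zero {r : ℝ} {w : Fin 3 → ℝ} {P : Tensor} (h : sqSize r w P ≤ 0) :
    r = 0 ∧ (∀ i, w i = 0) ∧ ∀ i j, P i j = 0 := by
  unfold sqSize at h
  simp only [Fin.sum_univ_three] at h
  refine ⟨?_, fun i => ?_, fun i j => ?_⟩
  · rw [← sq_eq_zero_iff]; apply le_antisymm _ (sq_nonneg _); nlinarith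
  · rw [← sq_eq_zero_iff]; apply le_antisymm _ (sq_nonneg _); fin_cases i <;> simp <;> nlinarith
  · rw [← sq_eq_zero_iff]; apply le_antisymm _ (sq_nonneg _)
    fin_cases i <;> fin_cases j <;> simp <;> nlinarith

/-- Expansion of the square norm that `traceFree_apply_bound` is based on. -/
lemma sum_sq_projection (Q : Tensor) (hQ : ∀ i j, Q i j = Q j i) (y s : Fin 3 → ℝ)
    (N d e : ℝ) :
    ∑ i, ∑ j, (N * Q i j - y i * s j - s i * y j + d * y i * y j + (if i = j then e else 0)) ^ 2
      = N ^ 2 * ∑ i, ∑ j, Q i j ^ 2 + 2 * (∑ k, y k ^ 2) * (∑ i, s i ^ 2)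
        + 2 * (∑ i, y i * s i) ^ 2 + d ^ 2 * (∑ k, y k ^ 2) ^ 2 + 3 * e ^ 2
        - 4 * N * (∑ i, s i * ∑ k, Q i k * y k) + 2 * N * d * (∑ i, y i * ∑ k, Q i k * y k)
        + 2 * N * e * (∑ i, Q i i) - 4 * d * (∑ k, y k ^ 2) * (∑ i, y i * s i)
        - 4 * e * (∑ i, y i * s i) + 2 * d * e * (∑ k, y k ^ 2) := by
  simp only [Fin.sum_univ_three]
  rw [hQ 1 0, hQ 2 0, hQ 2 1]
  simp
  ring

/-- For a symmetric trace-free `Q` and a unit vector `y`, the tangential part `Qy - (y·Qy) y` and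
the normal part `y·Qy` of `Qy` satisfy `2 |Qy - (y·Qy) y|² + 3/2 (y·Qy)² ≤ |Q|²`, with sharp
constants; this is the version homogeneous in `y`. -/
lemma traceFree_apply_bound (Q : Tensor) (hQ : ∀ i j, Q i j = Q j i) (htr : ∑ i, Q i i = 0)
    (y s : Fin 3 → ℝ) (hs : ∀ i, s i = ∑ k, Q i k * y k) :
    2 * (∑ k, y k ^ 2) * ∑ i, s i ^ 2 - (∑ i, y i * s i) ^ 2 / 2
      ≤ (∑ k, y k ^ 2) ^ 2 * ∑ i, ∑ j, Q i j ^ 2 := by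
  -- the left side differs from the right by the square norm of the part of `Q` that is
  -- transverse to `y` and trace-free there
  set N := ∑ k, y k ^ 2 with hN
  set a := ∑ i, y i * s i with ha
  by_cases hN0 : N = 0
  · have hy : ∀ k, y k = 0 := fun k => by
      have := (Finset.sum_eq_zero_iff_of_nonneg fun i _ => sq_nonneg (y i)).1 (hN ▸ hN0) k
        (Finset.mem_univ k)
      exact pow_eq_zero_iff two_ne_zero |>.1 this
    have ha0 : a = 0 := by simp [ha, hy]
    simp [hN0, ha0]
  have hNpos : 0 < N := lt_of_le_of_ne (Finset.sum_nonneg fun i _ => sq_nonneg _) (Ne.symm hN0)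
  have key : 0 ≤ ∑ i, ∑ j, (N * Q i j - y i * s j - s i * y j
      + (a / (2 * N)) * y i * y j + (if i = j then a / 2 else 0)) ^ 2 :=
    Finset.sum_nonneg fun i _ => Finset.sum_nonneg fun j _ => sq_nonneg _
  have expand : ∑ i, ∑ j, (N * Q i j - y i * s j - s i * y j
      + (a / (2 * N)) * y i * y j + (if i = j then a / 2 else 0)) ^ 2
      = N ^ 2 * ∑ i, ∑ j, Q i j ^ 2 - (2 * N * ∑ i, s i ^ 2 - a ^ 2 / 2) := by
    have hsum : ∑ i, s i * ∑ k, Q i k * y k = ∑ i, s i ^ 2 :=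
      Finset.sum_congr rfl fun i _ => by rw [← hs i, sq]
    have hysum : ∑ i, y i * ∑ k, Q i k * y k = a :=
      Finset.sum_congr rfl fun i _ => by rw [← hs i]
    rw [sum_sq_projection Q hQ y s, hsum, hysum, htr, ← hN, ← ha]
    field_simp
    ring
  linarith

/-- **Characteristic speeds.** The energy flux in any direction is at most `σ` times the energy,
where `σ² = c_s² + (ζ + 4η/3) / (ρ̄τ)`. -/
lemma linFlux_le {c2 ρbar ηbar τ ζ σ : ℝ} (hc : 0 < c2) (hρ : 0 < ρbar) (hη : 0 < ηbar)
    (hτ : 0 < τ) (hζ : 0 < ζ) (hσ : 0 < σ)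
    (hσ2 : σ ^ 2 = c2 + (ζ + 4 / 3 * ηbar) / (ρbar * τ))
    (r : ℝ) (w : Fin 3 → ℝ) (P : Tensor) (hP : ∀ i j, P i j = P j i)
    (y : Fin 3 → ℝ) {l : ℝ} (hl : 0 ≤ l) (hy : ∑ k, y k ^ 2 ≤ l ^ 2) :
    ∑ k, y k * linFlux c2 r w P k ≤ σ * l * linEnergy c2 ρbar ηbar τ ζ r w P := by
  have hE0 := linEnergy_nonneg hc hρ hη hτ hζ r w P
  set N := ∑ k, y k ^ 2 with hN
  by_cases hN0 : N = 0
  · have hy : ∀ k, y k = 0 := fun k => by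
      have := (Finset.sum_eq_zero_iff_of_nonneg fun i _ => sq_nonneg (y i)).1 (hN ▸ hN0) k
        (Finset.mem_univ k)
      exact pow_eq_zero_iff two_ne_zero |>.1 this
    simp only [hy, zero_mul, Finset.sum_const_zero]
    positivity
  have hNpos : 0 < N := lt_of_le_of_ne (Finset.sum_nonneg fun i _ => sq_nonneg _) (Ne.symm hN0)
  have hlpos : 0 < l := by
    rcases hl.lt_or_eq with h | h
    · exact h
    · rw [← h] at hy; norm_num at hy; linarith
  -- trace-free part, its action on `y`, and the normal component of the latter
  obtain ⟨π, hπ⟩ : ∃ π, π = ∑ i, P i i := ⟨_, rfl⟩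
  obtain ⟨Q, hQ⟩ : ∃ Q : Tensor, ∀ i j, Q i j = P i j - (if i = j then π / 3 else 0) :=
    ⟨fun i j => P i j - (if i = j then π / 3 else 0), fun _ _ => rfl⟩
  obtain ⟨s, hs⟩ : ∃ s : Fin 3 → ℝ, ∀ i, s i = ∑ k, Q i k * y k := ⟨_, fun _ => rfl⟩
  obtain ⟨a, ha⟩ : ∃ a, a = ∑ i, y i * s i := ⟨_, rfl⟩
  have hQsymm : ∀ i j, Q i j = Q j i := fun i j => by
    rw [hQ, hQ, hP i j]; simp only [eq_comm]
  have hQtr : ∑ i, Q i i = 0 := by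
    simp only [hQ, if_true, Finset.sum_sub_distrib, ← hπ]; simp; ring
  have hQsq : ∑ i, ∑ j, Q i j ^ 2 = ∑ i, ∑ j, P i j ^ 2 - (∑ i, P i i) ^ 2 / 3 := by
    simp only [hQ, hπ, Fin.sum_univ_three]; simp; ring
  have hbound := traceFree_apply_bound Q hQsymm hQtr y s hs
  rw [← hN, ← ha] at hbound
  set q := ∑ i, ∑ j, Q i j ^ 2 with hq
  -- `z` is the force exerted across the surface element `y`
  obtain ⟨z, hz⟩ : ∃ z : Fin 3 → ℝ, ∀ i, z i = (c2 * r + π / 3) * y i + s i :=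
    ⟨_, fun _ => rfl⟩
  have hflux : ∑ k, y k * linFlux c2 r w P k = ∑ i, w i * z i := by
    simp only [linFlux, hz, hs, hQ, Fin.sum_univ_three]
    rw [hP 1 0, hP 2 0, hP 2 1]
    simp
    ring
  obtain ⟨b, hb⟩ : ∃ b, b = N * ∑ i, s i ^ 2 - a ^ 2 := ⟨_, rfl⟩
  have hb0 : 0 ≤ b := by
    have := Finset.sum_mul_sq_le_sq_mul_sq Finset.univ y s
    rw [hb, ha, hN]; linarith
  have hzsq : N * ∑ i, z i ^ 2 = ((c2 * r + π / 3) * N + a) ^ 2 + b := by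
    rw [hb, ha, hN]
    simp only [hz, Fin.sum_univ_three]
    ring
  obtain ⟨α, hα⟩ : ∃ α, α = 4 / 3 * ηbar / (ρbar * τ) := ⟨_, rfl⟩
  obtain ⟨β, hβ⟩ : ∃ β, β = ζ / (ρbar * τ) := ⟨_, rfl⟩
  have hα0 : 0 < α := by rw [hα]; positivity
  have hβ0 : 0 < β := by rw [hβ]; positivity
  have hσαβ : σ ^ 2 = c2 + α + β := by rw [hσ2, hα, hβ]; ring
  obtain ⟨E2, hE2⟩ : ∃ E2, E2 = c2 / ρbar * r ^ 2 + τ / (2 * ηbar) * q + τ / (9 * ζ) * π ^ 2 :=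
    ⟨_, rfl⟩
  have hE : linEnergy c2 ρbar ηbar τ ζ r w P = (ρbar * ∑ i, w i ^ 2 + E2) / 2 := by
    rw [hE2, hQsq, hπ, linEnergy]; ring
  have hρE2 : ρbar * E2 = c2 * r ^ 2 + 2 / (3 * α) * q + (π / 3) ^ 2 / β := by
    rw [hE2, hα, hβ]; field_simp; ring
  have hcs : ((c2 * r + π / 3) * N + a) ^ 2
      ≤ (c2 + α + β) * (c2 * (r * N) ^ 2 + a ^ 2 / α + (π / 3 * N) ^ 2 / β) := by
    have h : (c2 + α + β) * (c2 * (r * N) ^ 2 + a ^ 2 / α + (π / 3 * N) ^ 2 / β)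
        - ((c2 * r + π / 3) * N + a) ^ 2
        = c2 / α * (α * (r * N) - a) ^ 2 + c2 / β * (β * (r * N) - π / 3 * N) ^ 2
          + (β * a - α * (π / 3 * N)) ^ 2 / (α * β) := by
      field_simp; ring
    have : 0 ≤ c2 / α * (α * (r * N) - a) ^ 2 + c2 / β * (β * (r * N) - π / 3 * N) ^ 2
          + (β * a - α * (π / 3 * N)) ^ 2 / (α * β) := by positivity
    linarith
  have hmain : ∑ i, z i ^ 2 ≤ σ ^ 2 * N * (ρbar * E2) := by
    have h1 : N * ∑ i, z i ^ 2 ≤ N * (σ ^ 2 * N * (ρbar * E2)) := by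
      have h2 : 2 / (3 * α) * (2 * b + 3 / 2 * a ^ 2) ≤ 2 / (3 * α) * (N ^ 2 * q) := by
        gcongr; rw [hb]; linarith
      have h3 : b ≤ σ ^ 2 * (4 / (3 * α) * b) := by
        have : (1 : ℝ) ≤ σ ^ 2 * (4 / (3 * α)) := by
          rw [hσαβ, mul_div_assoc', le_div_iff₀ (by positivity)]; linarith
        calc b = 1 * b := (one_mul b).symm
          _ ≤ σ ^ 2 * (4 / (3 * α)) * b := by gcongr
          _ = _ := by ring
      have h4 : N * (σ ^ 2 * N * (ρbar * E2))
          = σ ^ 2 * (c2 * (r * N) ^ 2 + (π / 3 * N) ^ 2 / β + 2 / (3 * α) * (N ^ 2 * q)) := by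
        rw [hρE2]; ring
      have h5 : 2 / (3 * α) * (2 * b + 3 / 2 * a ^ 2) = 4 / (3 * α) * b + a ^ 2 / α := by
        field_simp; ring
      rw [h4, hzsq]
      rw [h5] at h2
      rw [← hσαβ] at hcs
      have h6 := mul_le_mul_of_nonneg_left h2 (sq_nonneg σ)
      linarith
    exact le_of_mul_le_mul_left h1 hNpos
  have hE20 : 0 ≤ ρbar * E2 := by
    rw [hρE2]
    have : 0 ≤ q := Finset.sum_nonneg fun i _ => Finset.sum_nonneg fun j _ => sq_nonneg _
    positivity
  have hz2 : ∑ i, z i ^ 2 ≤ (σ * l) ^ 2 * (ρbar * E2) := by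
    refine hmain.trans ?_
    rw [mul_pow]
    gcongr
  -- Cauchy-Schwarz, weighted by `ρ̄ σ l`
  have hy2 : ∑ i, w i * z i
      ≤ ∑ i, (ρbar * (σ * l) / 2 * w i ^ 2 + 1 / (2 * ρbar * (σ * l)) * z i ^ 2) := by
    refine Finset.sum_le_sum fun i _ => ?_
    have h : ρbar * (σ * l) / 2 * w i ^ 2 + 1 / (2 * ρbar * (σ * l)) * z i ^ 2 - w i * z i
        = (ρbar * (σ * l) * w i - z i) ^ 2 / (2 * ρbar * (σ * l)) := by field_simp; ring
    have : 0 ≤ (ρbar * (σ * l) * w i - z i) ^ 2 / (2 * ρbar * (σ * l)) := by positivity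
    linarith
  rw [hflux, hE]
  refine hy2.trans ?_
  rw [Finset.sum_add_distrib, ← Finset.mul_sum, ← Finset.mul_sum]
  have h7 : 1 / (2 * ρbar * (σ * l)) * ∑ i, z i ^ 2
      ≤ 1 / (2 * ρbar * (σ * l)) * ((σ * l) ^ 2 * (ρbar * E2)) := by gcongr
  have h8 : 1 / (2 * ρbar * (σ * l)) * ((σ * l) ^ 2 * (ρbar * E2)) = σ * l * E2 / 2 := by
    field_simp
  linarith

/-! ### Energy balance for the linearized system -/

/-- The derivative of `linEnergy` along a curve with velocity `(rt, wt, Pt)`. -/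
noncomputable def linEnergyRate (c2 ρbar ηbar τ ζ r rt : ℝ) (w wt : Fin 3 → ℝ)
    (P Pt : Tensor) : ℝ :=
  c2 / ρbar * (r * rt) + ρbar * ∑ i, w i * wt i
    + τ / (2 * ηbar) * (∑ i, ∑ j, P i j * Pt i j - (∑ i, P i i) * (∑ i, Pt i i) / 3)
    + τ / (9 * ζ) * ((∑ i, P i i) * ∑ i, Pt i i)

/-- The partial derivative `∂ₖ` of the component `k` of `linFlux`, for fields whose partial
derivatives `∂ₖ` are `dr k`, `dw k` and `dP k`. -/
def linFluxDeriv (c2 r : ℝ) (dr w : Fin 3 → ℝ) (dw : Fin 3 → Fin 3 → ℝ) (P : Tensor)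
    (dP : Fin 3 → Tensor) (k : Fin 3) : ℝ :=
  c2 * (r * dw k k + w k * dr k) + ∑ i, (P i k * dw k i + w i * dP k i k)

/-- The energy balance of the linearized system: in terms of the residuals of its three
equations, all derivatives cancel. -/
lemma linEnergy_balance {c2 ρbar ηbar τ ζ : ℝ} (hρ : ρbar ≠ 0) (hη : ηbar ≠ 0)
    (hζ : ζ ≠ 0) (r rt : ℝ) (w wt dr : Fin 3 → ℝ) (P Pt : Tensor) (hP : ∀ i j, P i j = P j i)
    (dw : Fin 3 → Fin 3 → ℝ) (dP : Fin 3 → Tensor)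
    (m : ℝ) (n : Fin 3 → ℝ) (l : Tensor)
    (hm : m = rt + ρbar * ∑ k, dw k k)
    (hn : ∀ i, n i = ρbar * wt i + c2 * dr i + ∑ j, dP j i j)
    (hl : ∀ i j, l i j = τ * Pt i j + ηbar * dw i j + ηbar * dw j i
      + (if i = j then 1 else 0) * (ζ - 2 * ηbar / 3) * ∑ k, dw k k) :
    linEnergyRate c2 ρbar ηbar τ ζ r rt w wt P Pt + ∑ k, linFluxDeriv c2 r dr w dw P dP k
    = c2 / ρbar * (r * m) + ∑ i, w i * n i
      + 1 / (2 * ηbar) * (∑ i, ∑ j, P i j * l i j - (∑ i, P i i) * (∑ i, l i i) / 3)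
      + 1 / (9 * ζ) * ((∑ i, P i i) * ∑ i, l i i) := by
  have hl1 : ∑ i, l i i = τ * ∑ i, Pt i i + 3 * ζ * ∑ k, dw k k := by
    simp only [hl, Fin.sum_univ_three]; simp; ring
  have hl2 : ∑ i, ∑ j, P i j * l i j = τ * ∑ i, ∑ j, P i j * Pt i j
      + 2 * ηbar * ∑ k, ∑ i, P i k * dw k i
      + (ζ - 2 * ηbar / 3) * ((∑ i, P i i) * ∑ k, dw k k) := by
    simp only [hl, Fin.sum_univ_three]
    rw [hP 1 0, hP 2 0, hP 2 1]
    simp; ring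
  have hn1 : ∑ i, w i * n i = ρbar * (∑ i, w i * wt i) + c2 * (∑ i, w i * dr i)
      + ∑ k, ∑ i, w i * dP k i k := by
    simp only [hn, Fin.sum_univ_three]; ring
  have hf : ∑ k, (c2 * (r * dw k k + w k * dr k) + ∑ i, (P i k * dw k i + w i * dP k i k))
      = c2 * r * (∑ k, dw k k) + c2 * (∑ i, w i * dr i) + (∑ k, ∑ i, P i k * dw k i)
        + ∑ k, ∑ i, w i * dP k i k := by
    simp only [Fin.sum_univ_three]; ring
  simp only [linEnergyRate, linFluxDeriv]
  rw [hl1, hl2, hn1, hf, hm]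
  field_simp
  ring

lemma abs_le_sqrt_sqSize (r : ℝ) (w : Fin 3 → ℝ) (P : Tensor) :
    |r| ≤ √(sqSize r w P) ∧ (∀ i, |w i| ≤ √(sqSize r w P)) ∧
      ∀ i j, |P i j| ≤ √(sqSize r w P) := by
  have hw : 0 ≤ ∑ i, w i ^ 2 := Finset.sum_nonneg fun i _ => sq_nonneg _
  have hP' i : 0 ≤ ∑ j, P i j ^ 2 := Finset.sum_nonneg fun j _ => sq_nonneg _
  have hP : 0 ≤ ∑ i, ∑ j, P i j ^ 2 := Finset.sum_nonneg fun i _ => hP' i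
  unfold sqSize
  refine ⟨Real.abs_le_sqrt (by linarith), fun i => Real.abs_le_sqrt ?_,
    fun i j => Real.abs_le_sqrt ?_⟩
  · have := Finset.single_le_sum (fun i _ => sq_nonneg (w i)) (Finset.mem_univ i)
    nlinarith [sq_nonneg r]
  · have h1 := Finset.single_le_sum (fun j _ => sq_nonneg (P i j)) (Finset.mem_univ j)
    have h2 := Finset.single_le_sum (fun i _ => hP' i) (Finset.mem_univ i)
    nlinarith [sq_nonneg r]

lemma sum_le_three {f : Fin 3 → ℝ} {c : ℝ} (h : ∀ i, f i ≤ c) : ∑ i, f i ≤ 3 * c := by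
  rw [Fin.sum_univ_three]; linarith [h 0, h 1, h 2]

lemma abs_sum_le_three {f : Fin 3 → ℝ} {c : ℝ} (h : ∀ i, |f i| ≤ c) : |∑ i, f i| ≤ 3 * c :=
  (Finset.abs_sum_le_sum_abs _ _).trans (sum_le_three h)

lemma abs_mul_le {a b c d : ℝ} (h1 : |a| ≤ c) (h2 : |b| ≤ d) : |a * b| ≤ c * d := by
  rw [abs_mul]
  exact mul_le_mul h1 h2 (abs_nonneg _) ((abs_nonneg _).trans h1)

/-- Residuals of the size of the perturbation produce energy at a rate quadratic in it. -/
lemma residual_production_le {c2 ρbar ηbar ζ B : ℝ} (hc : 0 < c2) (hρ : 0 < ρbar)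
    (hη : 0 < ηbar) (hζ : 0 < ζ) (r m : ℝ) (w n : Fin 3 → ℝ) (P l : Tensor)
    (hm : |m| ≤ B * √(sqSize r w P)) (hn : ∀ i, |n i| ≤ B * √(sqSize r w P))
    (hl : ∀ i j, |l i j| ≤ B * √(sqSize r w P)) :
    c2 / ρbar * (r * m) + ∑ i, w i * n i
      + 1 / (2 * ηbar) * (∑ i, ∑ j, P i j * l i j - (∑ i, P i i) * (∑ i, l i i) / 3)
      + 1 / (9 * ζ) * ((∑ i, P i i) * ∑ i, l i i)
    ≤ (c2 / ρbar + 3 + 6 / ηbar + 1 / ζ) * B * sqSize r w P := by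
  obtain ⟨hr, hw, hP⟩ := abs_le_sqrt_sqSize r w P
  have hsq : 0 ≤ sqSize r w P := by unfold sqSize; positivity
  obtain ⟨ω, hω⟩ : ∃ ω, ω = √(sqSize r w P) := ⟨_, rfl⟩
  have hω2 : sqSize r w P = ω * ω := by rw [hω, Real.mul_self_sqrt hsq]
  simp only [← hω] at hr hw hP hm hn hl
  rw [hω2]
  have h1 : r * m ≤ ω * (B * ω) := (le_abs_self _).trans (abs_mul_le hr hm)
  have h2 : ∑ i, w i * n i ≤ 3 * (ω * (B * ω)) :=
    sum_le_three fun i => (le_abs_self _).trans (abs_mul_le (hw i) (hn i))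
  have h3 : ∑ i, ∑ j, P i j * l i j ≤ 3 * (3 * (ω * (B * ω))) :=
    sum_le_three fun i => sum_le_three fun j => (le_abs_self _).trans (abs_mul_le (hP i j) (hl i j))
  have h4 : |(∑ i, P i i) * ∑ i, l i i| ≤ 3 * ω * (3 * (B * ω)) :=
    abs_mul_le (abs_sum_le_three fun i => hP i i) (abs_sum_le_three fun i => hl i i)
  have h5 := abs_le.1 h4
  have e1 : c2 / ρbar * (r * m) ≤ c2 / ρbar * (ω * (B * ω)) := by gcongr
  have e2 : 1 / (2 * ηbar) * (∑ i, ∑ j, P i j * l i j - (∑ i, P i i) * (∑ i, l i i) / 3)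
      ≤ 1 / (2 * ηbar) * (12 * (B * (ω * ω))) := by
    refine mul_le_mul_of_nonneg_left ?_ (by positivity); linarith
  have e3 : 1 / (9 * ζ) * ((∑ i, P i i) * ∑ i, l i i) ≤ 1 / (9 * ζ) * (9 * (B * (ω * ω))) := by
    refine mul_le_mul_of_nonneg_left ?_ (by positivity); linarith
  have e4 : 1 / (2 * ηbar) * (12 * (B * (ω * ω))) = 6 / ηbar * B * (ω * ω) := by
    field_simp; ring
  have e5 : 1 / (9 * ζ) * (9 * (B * (ω * ω))) = 1 / ζ * B * (ω * ω) := by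
    field_simp
  linarith

/-! ### The equations of motion -/

lemma hasDerivAt_pressure (A : ℝ) {γ r : ℝ} (hr : 0 < r) :
    HasDerivAt (pressure A γ) (A * (γ * r ^ (γ - 1))) r :=
  (Real.hasDerivAt_rpow_const (Or.inl hr.ne')).const_mul A

lemma soundSpeed_sq {A γ r : ℝ} (hA : 0 < A) (hγ : 1 < γ) (hr : 0 < r) :
    soundSpeed A γ r ^ 2 = A * (γ * r ^ (γ - 1)) := by
  have : 0 < r ^ (γ - 1) := Real.rpow_pos_of_pos hr _
  rw [soundSpeed, (hasDerivAt_pressure A hr).deriv, Real.sq_sqrt (by positivity)]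

lemma soundSpeed_sq_pos {A γ r : ℝ} (hA : 0 < A) (hγ : 1 < γ) (hr : 0 < r) :
    0 < soundSpeed A γ r ^ 2 := by
  rw [soundSpeed_sq hA hγ hr]
  have : 0 < r ^ (γ - 1) := Real.rpow_pos_of_pos hr _
  positivity

lemma frontSpeed_sq {A γ τ ζ ρbar : ℝ} {η : ℝ → Tensor → ℝ} (hτ : 0 < τ) (hζ : 0 < ζ)
    (hρ : 0 < ρbar) (hη : 0 < η ρbar 0) :
    frontSpeed A γ τ ζ η ρbar ^ 2
      = soundSpeed A γ ρbar ^ 2 + (ζ + 4 / 3 * η ρbar 0) / (ρbar * τ) :=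
  Real.sq_sqrt (by positivity)

lemma frontSpeed_pos {A γ τ ζ ρbar : ℝ} {η : ℝ → Tensor → ℝ} (hτ : 0 < τ) (hζ : 0 < ζ)
    (hρ : 0 < ρbar) (hη : 0 < η ρbar 0) : 0 < frontSpeed A γ τ ζ η ρbar :=
  Real.sqrt_pos.2 (by positivity)

namespace IsC1Solution

variable {A γ τ ζ : ℝ} {η : ℝ → Tensor → ℝ} {T : ℝ} {ρ : ℝ → Space → ℝ}
  {v : ℝ → Space → Space} {S : ℝ → Space → Tensor}

lemma c1Slab_density (h : IsC1Solution A γ τ ζ η T ρ v S) : C1Slab T ρ := h.contDiffOn_density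

lemma c1Slab_velocity (h : IsC1Solution A γ τ ζ η T ρ v S) (i : Fin 3) :
    C1Slab T fun t x => v t x i :=
  (EuclideanSpace.proj i : Space →L[ℝ] ℝ).contDiff.comp_contDiffOn h.contDiffOn_velocity

lemma c1Slab_stress (h : IsC1Solution A γ τ ζ η T ρ v S) (i j : Fin 3) :
    C1Slab T fun t x => S t x i j :=
  contDiffOn_pi.1 (contDiffOn_pi.1 h.contDiffOn_stress i) j

lemma timeDeriv_density (h : IsC1Solution A γ τ ζ η T ρ v S) {t : ℝ} (ht : t ∈ Icc 0 T)
    (x : Space) :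
    timeDeriv T ρ t x + ρ t x * ∑ k, partialDeriv k (fun y => v t y k) x
      + ∑ k, v t x k * partialDeriv k (ρ t) x = 0 := by
  have h1 := h.mass t ht x
  have h2 := h.density_pos t ht x
  unfold divergence at h1
  field_simp at h1
  linarith

lemma timeDeriv_velocity (h : IsC1Solution A γ τ ζ η T ρ v S) (hA : 0 < A) (hγ : 1 < γ) {t : ℝ}
    (ht : t ∈ Icc 0 T) (x : Space) (i : Fin 3) :
    ρ t x * timeDeriv T (fun s y => v s y i) t x
      + soundSpeed A γ (ρ t x) ^ 2 * partialDeriv i (ρ t) x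
      + ρ t x * ∑ k, v t x k * partialDeriv k (fun y => v t y i) x
      + ∑ j, partialDeriv j (fun y => S t y i j) x = 0 := by
  have h1 := h.momentum t ht x i
  have h2 := (soundSpeed_sq_pos hA hγ (h.density_pos t ht x)).ne'
  generalize soundSpeed A γ (ρ t x) ^ 2 = c at h1 h2 ⊢
  field_simp at h1
  linarith

lemma timeDeriv_stress (h : IsC1Solution A γ τ ζ η T ρ v S) {t : ℝ} (ht : t ∈ Icc 0 T)
    (x : Space) (i j : Fin 3) :
    τ * timeDeriv T (fun s y => S s y i j) t x
      + η (ρ t x) (S t x) * partialDeriv i (fun y => v t y j) x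
      + η (ρ t x) (S t x) * partialDeriv j (fun y => v t y i) x
      + (if i = j then 1 else 0) * (ζ - 2 * η (ρ t x) (S t x) / 3)
          * ∑ k, partialDeriv k (fun y => v t y k) x
      + τ * ∑ k, (v t x k * partialDeriv k (fun y => S t y i j) x
          + S t x i j * partialDeriv k (fun y => v t y k) x)
      + S t x i j = 0 := by
  have h1 := h.relaxation t ht x i j
  have h2 (k : Fin 3) := partialDeriv_mul (k := k)
    ((h.c1Slab_velocity k).differentiableAt_slice ht x)
    ((h.c1Slab_stress i j).differentiableAt_slice ht x)
  simpa only [divergence, h2] using h1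

end IsC1Solution

/-- On a compact set of states, `c_s²` and the shear viscosity differ from their values at
equilibrium by at most a multiple of the size of the perturbation. -/
lemma exists_coefficient_bound {A γ : ℝ} (hA : 0 < A) (hγ : 1 < γ) {η : ℝ → Tensor → ℝ}
    (hη : ContDiffOn ℝ 1 (fun p : ℝ × Tensor => η p.1 p.2) (Ioi 0 ×ˢ univ))
    {ρbar a b M : ℝ} (ha : 0 < a) (haρ : a ≤ ρbar) (hρb : ρbar ≤ b) (hM : 0 ≤ M) :
    ∃ L, 0 ≤ L ∧ ∀ r ∈ Icc a b, ∀ (w : Fin 3 → ℝ) (P : Tensor), (∀ i j, |P i j| ≤ M) →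
      |soundSpeed A γ r ^ 2 - soundSpeed A γ ρbar ^ 2| ≤ L * √(sqSize (r - ρbar) w P) ∧
      |η r P - η ρbar 0| ≤ L * √(sqSize (r - ρbar) w P) := by
  have hpos : ∀ r ∈ Icc a b, 0 < r := fun r hr => ha.trans_le hr.1
  have hc : ContDiffOn ℝ 1 (fun r : ℝ => A * (γ * r ^ (γ - 1))) (Icc a b) := fun r hr =>
    (contDiffAt_const.mul (contDiffAt_const.mul
      (Real.contDiffAt_rpow_const_of_ne (hpos r hr).ne'))).contDiffWithinAt
  obtain ⟨L1, hL1⟩ := hc.exists_lipschitzOnWith one_ne_zero (convex_Icc a b) isCompact_Icc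
  obtain ⟨L2, hL2⟩ := (hη.mono (s := Ioi 0 ×ˢ univ) (t := Icc a b ×ˢ Metric.closedBall 0 M)
    (prod_mono (fun r hr => hpos r hr) (subset_univ _))).exists_lipschitzOnWith one_ne_zero
    ((convex_Icc a b).prod (convex_closedBall 0 M))
    (isCompact_Icc.prod (isCompact_closedBall 0 M))
  have hρ : ρbar ∈ Icc a b := ⟨haρ, hρb⟩
  refine ⟨max L1 L2, le_max_of_le_left L1.2, fun r hr w P hP => ?_⟩
  obtain ⟨h1, -, h3⟩ := abs_le_sqrt_sqSize (r - ρbar) w P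
  have hω := Real.sqrt_nonneg (sqSize (r - ρbar) w P)
  constructor
  · rw [soundSpeed_sq hA hγ (hpos r hr), soundSpeed_sq hA hγ (hpos _ hρ)]
    have := hL1.dist_le_mul r hr ρbar hρ
    rw [Real.dist_eq, Real.dist_eq] at this
    refine this.trans (mul_le_mul (le_max_left _ _) h1 (abs_nonneg _) (le_max_of_le_left L1.2))
  · have hPM : P ∈ Metric.closedBall (0 : Tensor) M := by
      rw [mem_closedBall_zero_iff, pi_norm_le_iff_of_nonneg hM]
      exact fun i => (pi_norm_le_iff_of_nonneg hM).2 fun j => hP i j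
    have := hL2.dist_le_mul (r, P) ⟨hr, hPM⟩ (ρbar, 0) ⟨hρ, Metric.mem_closedBall_self hM⟩
    rw [Real.dist_eq] at this
    refine this.trans (mul_le_mul (le_max_right _ _) ?_ dist_nonneg (le_max_of_le_left L1.2))
    rw [Prod.dist_eq, Real.dist_eq, dist_zero_right]
    refine max_le h1 ((pi_norm_le_iff_of_nonneg hω).2 fun i =>
      (pi_norm_le_iff_of_nonneg hω).2 fun j => h3 i j)

/-! ### Finite speed of propagation -/

namespace IsC1Solution

variable {A γ τ ζ : ℝ} {η : ℝ → Tensor → ℝ} {T : ℝ} {ρ : ℝ → Space → ℝ}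
  {v : ℝ → Space → Space} {S : ℝ → Space → Tensor} {ρbar : ℝ}

lemma hasDerivAt_linEnergy (h : IsC1Solution A γ τ ζ η T ρ v S) (c2 ηbar : ℝ) {t : ℝ}
    (ht : t ∈ Ioo 0 T) (x : Space) :
    HasDerivAt (fun s => linEnergy c2 ρbar ηbar τ ζ (ρ s x - ρbar) (v s x).ofLp (S s x))
      (linEnergyRate c2 ρbar ηbar τ ζ (ρ t x - ρbar) (timeDeriv T ρ t x)
        (v t x).ofLp (fun i => timeDeriv T (fun s y => v s y i) t x)
        (S t x) (fun i j => timeDeriv T (fun s y => S s y i j) t x)) t := by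
  have hr := (h.c1Slab_density.hasDerivAt_time ht x).sub_const ρbar
  have hw i := (h.c1Slab_velocity i).hasDerivAt_time ht x
  have hP i j := (h.c1Slab_stress i j).hasDerivAt_time ht x
  have hw2 := HasDerivAt.fun_sum (u := Finset.univ) fun i _ => (hw i).fun_pow 2
  have hP2 := HasDerivAt.fun_sum (u := Finset.univ) fun i _ =>
    HasDerivAt.fun_sum (u := Finset.univ) fun j _ => (hP i j).fun_pow 2
  have htr := (HasDerivAt.fun_sum (u := Finset.univ) fun i _ => hP i i).fun_pow 2
  refine HasDerivAt.congr_deriv (((((hr.fun_pow 2).const_mul (c2 / ρbar)).fun_add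
    (hw2.const_mul ρbar)).fun_add ((hP2.fun_sub (htr.div_const 3)).const_mul (τ / (2 * ηbar)))
    |>.fun_add (htr.const_mul (τ / (9 * ζ)))).div_const 2) ?_
  simp only [linEnergyRate, Fin.sum_univ_three]
  push_cast
  ring

lemma partialDeriv_linFlux (h : IsC1Solution A γ τ ζ η T ρ v S) (c2 : ℝ) {t : ℝ}
    (ht : t ∈ Icc 0 T) (x : Space) (k : Fin 3) :
    partialDeriv k (fun y => linFlux c2 (ρ t y - ρbar) (v t y).ofLp (S t y) k) x
      = linFluxDeriv c2 (ρ t x - ρbar) (fun l => partialDeriv l (ρ t) x) (v t x).ofLp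
        (fun l i => partialDeriv l (fun y => v t y i) x) (S t x)
        (fun l i j => partialDeriv l (fun y => S t y i j) x) k := by
  have hr := h.c1Slab_density.differentiableAt_slice ht x
  have hw i := (h.c1Slab_velocity i).differentiableAt_slice ht x
  have hP i j := (h.c1Slab_stress i j).differentiableAt_slice ht x
  have hr' : partialDeriv k (fun y => ρ t y - ρbar) x = partialDeriv k (ρ t) x := by
    rw [partialDeriv, (hr.hasFDerivAt.sub_const ρbar).fderiv, partialDeriv]
  unfold linFlux linFluxDeriv
  rw [partialDeriv_add (by fun_prop) (by fun_prop), partialDeriv_mul (by fun_prop) (hw k),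
    partialDeriv_mul (by fun_prop) (by fun_prop), partialDeriv_const, hr',
    partialDeriv_sum fun i _ => (hP i k).fun_mul (hw i)]
  simp only [partialDeriv_mul (hP _ _) (hw _)]
  ring

lemma c1Slab_linEnergy (h : IsC1Solution A γ τ ζ η T ρ v S) (c2 ηbar : ℝ) :
    C1Slab T fun t x => linEnergy c2 ρbar ηbar τ ζ (ρ t x - ρbar) (v t x).ofLp (S t x) := by
  have hr := h.c1Slab_density
  have hw := h.c1Slab_velocity
  have hP := h.c1Slab_stress
  unfold C1Slab linEnergy at *
  fun_prop

lemma contDiff_linFlux (h : IsC1Solution A γ τ ζ η T ρ v S) (c2 : ℝ) {t : ℝ}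
    (ht : t ∈ Icc 0 T) (k : Fin 3) :
    ContDiff ℝ 1 fun y => linFlux c2 (ρ t y - ρbar) (v t y).ofLp (S t y) k := by
  have hr := h.c1Slab_density.contDiff_slice ht
  have hw i := (h.c1Slab_velocity i).contDiff_slice ht
  have hP i j := (h.c1Slab_stress i j).contDiff_slice ht
  unfold linFlux
  fun_prop

/-- On compact sets the nonlinear terms act on the energy of a perturbation of the equilibrium
like terms of order zero: they are products of the perturbation with derivatives of the solution,
which are bounded there. -/
lemma exists_energy_production_bound (h : IsC1Solution A γ τ ζ η T ρ v S)
    (hA : 0 < A) (hγ : 1 < γ) (hτ : 0 < τ) (hζ : 0 < ζ)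
    (hη : ContDiffOn ℝ 1 (fun p : ℝ × Tensor => η p.1 p.2) (Ioi 0 ×ˢ univ))
    (hρbar : 0 < ρbar) (hηbar : 0 < η ρbar 0) (hT : 0 < T) {K : Set Space} (hK : IsCompact K) :
    ∃ C, ∀ t ∈ Ioo 0 T, ∀ x ∈ K,
      linEnergyRate (soundSpeed A γ ρbar ^ 2) ρbar (η ρbar 0) τ ζ
          (ρ t x - ρbar) (timeDeriv T ρ t x)
          (v t x).ofLp (fun i => timeDeriv T (fun s y => v s y i) t x)
          (S t x) (fun i j => timeDeriv T (fun s y => S s y i j) t x)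
        + ∑ k, partialDeriv k
          (fun y => linFlux (soundSpeed A γ ρbar ^ 2) (ρ t y - ρbar) (v t y).ofLp (S t y) k) x
      ≤ C * linEnergy (soundSpeed A γ ρbar ^ 2) ρbar (η ρbar 0) τ ζ
          (ρ t x - ρbar) (v t x).ofLp (S t x) := by
  have hc2 := soundSpeed_sq_pos hA hγ hρbar
  -- uniform bounds for the solution and its derivatives
  obtain ⟨Mρ, hMρ0, hMρ⟩ := h.c1Slab_density.exists_bound hK
  choose Mv hMv0 hMv using fun i => (h.c1Slab_velocity i).exists_bound hK
  choose MS hMS0 hMS using fun i j => (h.c1Slab_stress i j).exists_bound hK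
  obtain ⟨Dρ, hDρ0, hDρ⟩ := h.c1Slab_density.exists_deriv_bound hT hK
  choose Dv hDv0 hDv using fun i => (h.c1Slab_velocity i).exists_deriv_bound hT hK
  choose DS hDS0 hDS using fun i j => (h.c1Slab_stress i j).exists_deriv_bound hT hK
  obtain ⟨D, hD⟩ : ∃ D, D = Mρ + (∑ i, Mv i) + (∑ i, ∑ j, MS i j) + Dρ + (∑ i, Dv i)
      + ∑ i, ∑ j, DS i j := ⟨_, rfl⟩
  have s1 : 0 ≤ ∑ i, Mv i := Finset.sum_nonneg fun i _ => hMv0 i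
  have s2 : 0 ≤ ∑ i, ∑ j, MS i j :=
    Finset.sum_nonneg fun i _ => Finset.sum_nonneg fun j _ => hMS0 i j
  have s3 : 0 ≤ ∑ i, Dv i := Finset.sum_nonneg fun i _ => hDv0 i
  have s4 : 0 ≤ ∑ i, ∑ j, DS i j :=
    Finset.sum_nonneg fun i _ => Finset.sum_nonneg fun j _ => hDS0 i j
  have b1 : Mρ ≤ D := by linarith
  have b2 i : Mv i ≤ D := by
    have := Finset.single_le_sum (fun i _ => hMv0 i) (Finset.mem_univ i); linarith
  have b3 i j : MS i j ≤ D := by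
    have h1 := Finset.single_le_sum (fun j _ => hMS0 i j) (Finset.mem_univ j)
    have h2 := Finset.single_le_sum (fun i _ => Finset.sum_nonneg fun j _ => hMS0 i j)
      (Finset.mem_univ i) (s := Finset.univ) (f := fun i => ∑ j, MS i j)
    linarith
  have b4 : Dρ ≤ D := by linarith
  have b5 i : Dv i ≤ D := by
    have := Finset.single_le_sum (fun i _ => hDv0 i) (Finset.mem_univ i); linarith
  have b6 i j : DS i j ≤ D := by
    have h1 := Finset.single_le_sum (fun j _ => hDS0 i j) (Finset.mem_univ j)
    have h2 := Finset.single_le_sum (fun i _ => Finset.sum_nonneg fun j _ => hDS0 i j)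
      (Finset.mem_univ i) (s := Finset.univ) (f := fun i => ∑ j, DS i j)
    linarith
  have hD0 : 0 ≤ D := by linarith
  -- a positive lower bound for the density
  obtain ⟨a, ha, haρ, hab⟩ : ∃ a, 0 < a ∧ a ≤ ρbar ∧ ∀ t ∈ Icc 0 T, ∀ x ∈ K, a ≤ ρ t x := by
    rcases K.eq_empty_or_nonempty with rfl | hne
    · exact ⟨ρbar, hρbar, le_rfl, by simp⟩
    · obtain ⟨⟨t₀, x₀⟩, hp, hmin⟩ := (isCompact_Icc.prod hK).exists_isMinOn
        ((nonempty_Icc.2 hT.le).prod hne)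
        (h.c1Slab_density.continuousOn.mono (prod_mono_right (subset_univ K)))
      exact ⟨min ρbar (ρ t₀ x₀), lt_min hρbar (h.density_pos t₀ hp.1 x₀), min_le_left _ _,
        fun t ht x hx => (min_le_right _ _).trans (hmin (a := (t, x)) ⟨ht, hx⟩)⟩
  obtain ⟨L, hL0, hL⟩ := exists_coefficient_bound hA hγ hη ha haρ (le_max_left ρbar D) hD0
  obtain ⟨C, hC0, hC⟩ := exists_sqSize_le hc2 hρbar hηbar hτ hζ
  obtain ⟨B, hB⟩ : ∃ B, B = 6 * D + (D + L * D + D * (3 * D))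
    + (L * (4 * D) + τ * (6 * D) + 1) := ⟨_, rfl⟩
  have hB0 : 0 ≤ B := by rw [hB]; positivity
  refine ⟨(soundSpeed A γ ρbar ^ 2 / ρbar + 3 + 6 / η ρbar 0 + 1 / ζ) * B * C,
    fun t ht x hx => ?_⟩
  have ht' := Ioo_subset_Icc_self ht
  simp only [h.partialDeriv_linFlux _ ht' x]
  rw [linEnergy_balance hρbar.ne' hηbar.ne' hζ.ne' _ _ _ _ _ _ _ (h.stress_symm t ht' x) _ _
    _ _ _ rfl (fun i => rfl) (fun i j => rfl)]
  obtain ⟨hr, hw, hP⟩ := abs_le_sqrt_sqSize (ρ t x - ρbar) (v t x).ofLp (S t x)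
  obtain ⟨hcs, hηs⟩ := hL (ρ t x) ⟨hab t ht' x hx,
    (le_abs_self _).trans ((hMρ t ht' x hx).trans (b1.trans (le_max_right _ _)))⟩
    (v t x).ofLp (S t x) fun i j => (hMS i j t ht' x hx).trans (b3 i j)
  have e1 := h.timeDeriv_density ht' x
  have e2 := h.timeDeriv_velocity hA hγ ht' x
  have e3 := h.timeDeriv_stress ht' x
  have hρD : |ρ t x| ≤ D := (hMρ t ht' x hx).trans b1
  have hdρ k : |partialDeriv k (ρ t) x| ≤ D := ((hDρ t ht x hx).2 k).trans b4
  have htv i : |timeDeriv T (fun s y => v s y i) t x| ≤ D := ((hDv i t ht x hx).1).trans (b5 i)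
  have hdv i k : |partialDeriv k (fun y => v t y i) x| ≤ D :=
    ((hDv i t ht x hx).2 k).trans (b5 i)
  have hdS i j k : |partialDeriv k (fun y => S t y i j) x| ≤ D :=
    ((hDS i j t ht x hx).2 k).trans (b6 i j)
  set ω := √(sqSize (ρ t x - ρbar) (v t x).ofLp (S t x)) with hω
  have hω0 : 0 ≤ ω := Real.sqrt_nonneg _
  refine (residual_production_le (B := B) hc2 hρbar hηbar hζ _ _ _ _ _ _ ?_ ?_ ?_).trans ?_
  · rw [show timeDeriv T ρ t x + ρbar * ∑ k, partialDeriv k (fun y => v t y k) x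
      = -((ρ t x - ρbar) * ∑ k, partialDeriv k (fun y => v t y k) x
        + ∑ k, v t x k * partialDeriv k (ρ t) x) by linarith, abs_neg]
    refine (abs_add_le _ _).trans ((add_le_add
      (abs_mul_le hr (abs_sum_le_three fun k => hdv k k))
      (abs_sum_le_three fun k => abs_mul_le (hw k) (hdρ k))).trans ?_)
    have : 0 ≤ (D + L * D + D * (3 * D) + (L * (4 * D) + τ * (6 * D) + 1)) * ω := by positivity
    rw [hB]; linarith
  · intro i
    rw [show ρbar * timeDeriv T (fun s y => v s y i) t x
          + soundSpeed A γ ρbar ^ 2 * partialDeriv i (ρ t) x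
          + ∑ j, partialDeriv j (fun y => S t y i j) x
        = -((ρ t x - ρbar) * timeDeriv T (fun s y => v s y i) t x
          + (soundSpeed A γ (ρ t x) ^ 2 - soundSpeed A γ ρbar ^ 2) * partialDeriv i (ρ t) x
          + ρ t x * ∑ k, v t x k * partialDeriv k (fun y => v t y i) x) by
      linarith [e2 i], abs_neg]
    refine (abs_add_three _ _ _).trans ((add_le_add (add_le_add (abs_mul_le hr (htv i))
      (abs_mul_le hcs (hdρ i))) (abs_mul_le hρD (abs_sum_le_three fun k =>
        abs_mul_le (hw k) (hdv i k)))).trans ?_)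
    have : 0 ≤ (6 * D + (L * (4 * D) + τ * (6 * D) + 1)) * ω := by positivity
    rw [hB]; linarith
  · intro i j
    have hδ : |(if i = j then (1 : ℝ) else 0)| ≤ 1 := by split_ifs <;> simp
    rw [show τ * timeDeriv T (fun s y => S s y i j) t x
          + η ρbar 0 * partialDeriv i (fun y => v t y j) x
          + η ρbar 0 * partialDeriv j (fun y => v t y i) x
          + (if i = j then 1 else 0) * (ζ - 2 * η ρbar 0 / 3)
            * ∑ k, partialDeriv k (fun y => v t y k) x
        = -((η (ρ t x) (S t x) - η ρbar 0) * (partialDeriv i (fun y => v t y j) x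
            + partialDeriv j (fun y => v t y i) x
            + (if i = j then 1 else 0) * (-2 / 3 * ∑ k, partialDeriv k (fun y => v t y k) x))
          + τ * ∑ k, (v t x k * partialDeriv k (fun y => S t y i j) x
            + S t x i j * partialDeriv k (fun y => v t y k) x)
          + S t x i j) by
      linarith [e3 i j], abs_neg]
    have hdiv : |-2 / 3 * ∑ k, partialDeriv k (fun y => v t y k) x| ≤ 2 / 3 * (3 * D) :=
      abs_mul_le (by norm_num [abs_of_neg]) (abs_sum_le_three fun k => hdv k k)
    refine (abs_add_three _ _ _).trans ((add_le_add (add_le_add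
      (abs_mul_le hηs ((abs_add_three _ _ _).trans (add_le_add (add_le_add (hdv j i) (hdv i j))
        (abs_mul_le hδ hdiv))))
      (abs_mul_le (abs_of_pos hτ).le (abs_sum_le_three fun k => (abs_add_le _ _).trans
        (add_le_add (abs_mul_le (hw k) (hdS i j k)) (abs_mul_le (hP i j) (hdv k k))))))
      (hP i j)).trans ?_)
    have : 0 ≤ (6 * D + (D + L * D + D * (3 * D))) * ω := by positivity
    rw [hB]; linarith
  · calc _ ≤ (soundSpeed A γ ρbar ^ 2 / ρbar + 3 + 6 / η ρbar 0 + 1 / ζ) * B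
          * (C * linEnergy (soundSpeed A γ ρbar ^ 2) ρbar (η ρbar 0) τ ζ
          (ρ t x - ρbar) (v t x).ofLp (S t x)) :=
        mul_le_mul_of_nonneg_left (hC _ _ _) (by positivity)
      _ = _ := by ring

end IsC1Solution

/-- Grönwall's inequality with the derivative bound assumed in the open interval only. -/
lemma nonpos_of_hasDerivAt_le {f f' : ℝ → ℝ} {a b C : ℝ} (hf : ContinuousOn f (Icc a b))
    (hf' : ∀ t ∈ Ioo a b, HasDerivAt f (f' t) t ∧ f' t ≤ C * f t) (ha : f a ≤ 0)
    {t : ℝ} (ht : t ∈ Icc a b) : f t ≤ 0 := by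
  have hanti : AntitoneOn (fun t => Real.exp (-C * t) * f t) (Icc a b) := by
    have hd : ∀ s ∈ Ioo a b, HasDerivAt (fun t => Real.exp (-C * t) * f t)
        (Real.exp (-C * s) * (f' s - C * f s)) s := fun s hs =>
      ((((hasDerivAt_id s).const_mul (-C)).exp).fun_mul (hf' s hs).1).congr_deriv
        (by simp only [id]; ring)
    refine antitoneOn_of_deriv_nonpos (convex_Icc a b) (by fun_prop) ?_ ?_
    · rw [interior_Icc]
      exact fun s hs => (hd s hs).differentiableAt.differentiableWithinAt
    · rw [interior_Icc]
      intro s hs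
      rw [(hd s hs).deriv]
      exact mul_nonpos_of_nonneg_of_nonpos (Real.exp_pos _).le (by linarith [(hf' s hs).2])
  have h1 := hanti (left_mem_Icc.2 (ht.1.trans ht.2)) ht ht.1
  have h2 : Real.exp (-C * a) * f a ≤ 0 :=
    mul_nonpos_of_nonneg_of_nonpos (Real.exp_pos _).le ha
  by_contra! hpos
  have h3 : 0 < Real.exp (-C * t) * f t := by positivity
  simp only at h1
  linarith

/-! ### Cutoff functions of cones -/

/-- A smooth cutoff function, positive exactly in the interior of the double cone
`|x - x₀| < σ |t₀ - t|`. -/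
noncomputable def coneCutoff (σ t₀ : ℝ) (x₀ : Space) (t : ℝ) (x : Space) : ℝ :=
  expNegInvGlue (σ ^ 2 * (t₀ - t) ^ 2 - ∑ k, (x k - x₀ k) ^ 2)

section Cone

variable {σ t₀ : ℝ} {x₀ : Space}

lemma coneCutoff_nonneg (t : ℝ) (x : Space) : 0 ≤ coneCutoff σ t₀ x₀ t x :=
  expNegInvGlue.nonneg _

lemma c1Slab_coneCutoff (T : ℝ) : C1Slab T (coneCutoff σ t₀ x₀) := by
  have h : ContDiff ℝ 1 expNegInvGlue := expNegInvGlue.contDiff (n := 1)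
  unfold C1Slab coneCutoff
  fun_prop

lemma hasDerivAt_expNegInvGlue (q : ℝ) : HasDerivAt expNegInvGlue (deriv expNegInvGlue q) q :=
  ((expNegInvGlue.contDiff (n := 1)).differentiable one_ne_zero q).hasDerivAt

lemma deriv_expNegInvGlue_of_nonpos {q : ℝ} (hq : q ≤ 0) : deriv expNegInvGlue q = 0 :=
  IsLocalMin.deriv_eq_zero <| Eventually.of_forall fun z => by
    rw [expNegInvGlue.zero_of_nonpos hq]; exact expNegInvGlue.nonneg z

lemma hasDerivAt_coneCutoff (t : ℝ) (x : Space) :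
    HasDerivAt (fun s => coneCutoff σ t₀ x₀ s x)
      (deriv expNegInvGlue (σ ^ 2 * (t₀ - t) ^ 2 - ∑ k, (x k - x₀ k) ^ 2)
        * (-2 * σ ^ 2 * (t₀ - t))) t := by
  have h : HasDerivAt (fun s => σ ^ 2 * (t₀ - s) ^ 2 - ∑ k, (x k - x₀ k) ^ 2)
      (-2 * σ ^ 2 * (t₀ - t)) t :=
    (((((hasDerivAt_id t).const_sub t₀).fun_pow 2).const_mul (σ ^ 2)).sub_const _).congr_deriv
      (by simp; ring)
  exact (hasDerivAt_expNegInvGlue _).comp t h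

lemma partialDeriv_coneCutoff (t : ℝ) (x : Space) (k : Fin 3) :
    partialDeriv k (coneCutoff σ t₀ x₀ t) x
      = deriv expNegInvGlue (σ ^ 2 * (t₀ - t) ^ 2 - ∑ k, (x k - x₀ k) ^ 2)
        * (-2 * (x k - x₀ k)) := by
  have hcoord (i : Fin 3) : DifferentiableAt ℝ (fun y : Space => y i) x := by fun_prop
  have h1 (i : Fin 3) : partialDeriv k (fun y => (y i - x₀ i) ^ 2) x
      = 2 * (x i - x₀ i) * (if i = k then 1 else 0) := by
    rw [← partialDeriv_coord (k := k) (x := x) i]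
    exact partialDeriv_comp (φ := fun z => (z - x₀ i) ^ 2)
      ((((hasDerivAt_id (x i)).sub_const (x₀ i)).fun_pow 2).congr_deriv (by simp)) (hcoord i)
  have h2 : HasDerivAt (fun z => expNegInvGlue (σ ^ 2 * (t₀ - t) ^ 2 - z))
      (deriv expNegInvGlue (σ ^ 2 * (t₀ - t) ^ 2 - ∑ k, (x k - x₀ k) ^ 2) * -1)
      (∑ k, (x k - x₀ k) ^ 2) :=
    (hasDerivAt_expNegInvGlue _).comp _ ((hasDerivAt_id _).const_sub _)
  unfold coneCutoff
  rw [partialDeriv_comp (f := fun y : Space => ∑ k, (y k - x₀ k) ^ 2) h2 (by fun_prop),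
    partialDeriv_sum fun i _ => by fun_prop]
  simp only [h1, mul_ite, mul_one, mul_zero, Finset.sum_ite_eq', Finset.mem_univ, if_true]
  ring

lemma coneCutoff_eq_zero {t : ℝ} {x : Space} (h : σ * |t₀ - t| ≤ ‖x - x₀‖) (hσ : 0 ≤ σ) :
    coneCutoff σ t₀ x₀ t x = 0 := by
  refine expNegInvGlue.zero_of_nonpos ?_
  have h1 := EuclideanSpace.real_norm_sq_eq (x - x₀)
  have h2 := pow_le_pow_left₀ (by positivity) h 2
  rw [h1, mul_pow, sq_abs] at h2
  simpa using h2

lemma coneCutoff_apex_pos {t : ℝ} (hσ : 0 < σ) (ht : t < t₀) : 0 < coneCutoff σ t₀ x₀ t x₀ := by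
  have : 0 < t₀ - t := sub_pos.2 ht
  refine expNegInvGlue.pos_of_pos ?_
  simp only [sub_self]
  norm_num
  positivity

end Cone

namespace IsC1Solution

variable {A γ τ ζ : ℝ} {η : ℝ → Tensor → ℝ} {T : ℝ} {ρ : ℝ → Space → ℝ}
  {v : ℝ → Space → Space} {S : ℝ → Space → Tensor} {ρbar : ℝ}

/-- The energy in the slices of the backward cone with apex `(t₀, x₀)` and slope `c̄_v`, weighted
with the cutoff function of the cone, vanishes up to time `t₀` if it vanishes initially. -/
lemma integral_energy_cone_nonpos (h : IsC1Solution A γ τ ζ η T ρ v S)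
    (hA : 0 < A) (hγ : 1 < γ) (hτ : 0 < τ) (hζ : 0 < ζ)
    (hη : ContDiffOn ℝ 1 (fun p : ℝ × Tensor => η p.1 p.2) (Ioi 0 ×ˢ univ))
    (hρbar : 0 < ρbar) (hηbar : 0 < η ρbar 0) {t₀ : ℝ} (ht₀ : 0 < t₀) (ht₀T : t₀ ≤ T) (x₀ : Space)
    (h0 : ∀ x, linEnergy (soundSpeed A γ ρbar ^ 2) ρbar (η ρbar 0) τ ζ
          (ρ 0 x - ρbar) (v 0 x).ofLp (S 0 x)
        * coneCutoff (frontSpeed A γ τ ζ η ρbar) t₀ x₀ 0 x = 0)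
    {t : ℝ} (ht : t ∈ Icc 0 t₀) :
    ∫ x, linEnergy (soundSpeed A γ ρbar ^ 2) ρbar (η ρbar 0) τ ζ
          (ρ t x - ρbar) (v t x).ofLp (S t x)
        * coneCutoff (frontSpeed A γ τ ζ η ρbar) t₀ x₀ t x ≤ 0 := by
  have hc2 := soundSpeed_sq_pos hA hγ hρbar
  have hσ2 := frontSpeed_sq (A := A) (γ := γ) hτ hζ hρbar hηbar
  have hσ := frontSpeed_pos (A := A) (γ := γ) hτ hζ hρbar hηbar
  set c2 := soundSpeed A γ ρbar ^ 2 with hc2def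
  set σ := frontSpeed A γ τ ζ η ρbar
  have hT : 0 < T := ht₀.trans_le ht₀T
  have hK : IsCompact (Metric.closedBall x₀ (σ * T)) := isCompact_closedBall _ _
  set K := Metric.closedBall x₀ (σ * T) with hKdef
  have hφ0 : ∀ t ∈ Icc 0 T, ∀ x ∉ K, coneCutoff σ t₀ x₀ t x = 0 := by
    intro t ht x hx
    refine coneCutoff_eq_zero ?_ hσ.le
    rw [hKdef, Metric.mem_closedBall, not_le, dist_eq_norm] at hx
    refine le_trans ?_ hx.le
    gcongr
    rw [abs_le]
    constructor <;> linarith [ht.1, ht.2]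
  obtain ⟨C, hC⟩ := h.exists_energy_production_bound hA hγ hτ hζ hη hρbar hηbar hT hK
  rw [← hc2def] at hC
  have hu : C1Slab T fun t x => linEnergy c2 ρbar (η ρbar 0) τ ζ (ρ t x - ρbar) (v t x).ofLp
      (S t x) * coneCutoff σ t₀ x₀ t x :=
    (h.c1Slab_linEnergy c2 (η ρbar 0)).mul (c1Slab_coneCutoff T)
  have hu0 : ∀ t ∈ Icc 0 T, ∀ x ∉ K, linEnergy c2 ρbar (η ρbar 0) τ ζ (ρ t x - ρbar)
      (v t x).ofLp (S t x) * coneCutoff σ t₀ x₀ t x = 0 := fun t ht x hx => by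
    rw [hφ0 t ht x hx, mul_zero]
  have hsub : Icc 0 t₀ ⊆ Icc 0 T := Icc_subset_Icc_right ht₀T
  have hderiv : ∀ t ∈ Ioo 0 t₀, ∃ d, HasDerivAt (fun t => ∫ x, linEnergy c2 ρbar (η ρbar 0) τ ζ
      (ρ t x - ρbar) (v t x).ofLp (S t x) * coneCutoff σ t₀ x₀ t x) d t ∧
      d ≤ C * ∫ x, linEnergy c2 ρbar (η ρbar 0) τ ζ
      (ρ t x - ρbar) (v t x).ofLp (S t x) * coneCutoff σ t₀ x₀ t x := by
    intro t ht
    have htT : t ∈ Ioo 0 T := ⟨ht.1, ht.2.trans_le ht₀T⟩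
    have htT' := Ioo_subset_Icc_self htT
    have hflux k := h.contDiff_linFlux (ρbar := ρbar) c2 htT' k
    have hcut : ContDiff ℝ 1 (coneCutoff σ t₀ x₀ t) :=
      C1Slab.contDiff_slice (c1Slab_coneCutoff T) htT'
    obtain ⟨hint, hder⟩ := hu.hasDerivAt_integral_of_balance hK hu0 htT
      (h := fun k y => linFlux c2 (ρ t y - ρbar) (v t y).ofLp (S t y) k * coneCutoff σ t₀ x₀ t y)
      (fun k => (hflux k).mul hcut)
      (fun k x hx => by rw [hφ0 t htT' x hx, mul_zero]) (fun x => rfl)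
    refine ⟨_, hder, ?_⟩
    rw [← integral_const_mul]
    refine integral_mono hint ((hu.integrable_slice hK hu0 htT').const_mul C) fun x => ?_
    simp only
    rw [timeDeriv_eq_deriv htT, ((h.hasDerivAt_linEnergy c2 (η ρbar 0) htT x).fun_mul
      (hasDerivAt_coneCutoff t x)).deriv]
    have hp k := partialDeriv_mul (k := k) ((hflux k).differentiable one_ne_zero x)
      (hcut.differentiable one_ne_zero x)
    simp only [hp, partialDeriv_coneCutoff]
    set q := σ ^ 2 * (t₀ - t) ^ 2 - ∑ k, (x k - x₀ k) ^ 2 with hq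
    rcases le_or_gt q 0 with hq0 | hq0
    · have hφ : coneCutoff σ t₀ x₀ t x = 0 := expNegInvGlue.zero_of_nonpos hq0
      simp [hφ, deriv_expNegInvGlue_of_nonpos hq0]
    · have hl : 0 ≤ σ * (t₀ - t) := mul_nonneg hσ.le (by linarith [ht.2])
      have hy : ∑ k, (-(x k - x₀ k)) ^ 2 ≤ (σ * (t₀ - t)) ^ 2 := by
        simp only [neg_sq]; rw [mul_pow]; linarith
      have hxK : x ∈ K := by
        by_contra hx
        have := hφ0 t htT' x hx
        rw [coneCutoff, ← hq] at this
        exact (expNegInvGlue.pos_of_pos hq0).ne' this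
      have hprod := mul_le_mul_of_nonneg_right (hC t htT x hxK)
        (coneCutoff_nonneg (σ := σ) (t₀ := t₀) (x₀ := x₀) t x)
      -- across the mantle of the cone energy can only flow out
      have hbd := mul_le_mul_of_nonneg_left (linFlux_le hc2 hρbar hηbar hτ hζ hσ hσ2
        (ρ t x - ρbar) (v t x).ofLp (S t x) (h.stress_symm t htT' x) _ hl hy)
        (mul_nonneg zero_le_two (expNegInvGlue.monotone.deriv_nonneg (x := q)))
      simp only [Finset.sum_add_distrib, Fin.sum_univ_three] at hprod hbd ⊢
      linarith
  choose! d hd using hderiv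
  exact nonpos_of_hasDerivAt_le (hu.continuousOn_integral hK hu0 |>.mono hsub) hd
    (by simp [h0]) ht

/-- **Finite speed of propagation.** A disturbance of the equilibrium that is initially contained
in the ball of radius `R` stays in the ball of radius `R + c̄_v t`. -/
theorem eq_equilibrium_of_le_norm (h : IsC1Solution A γ τ ζ η T ρ v S)
    (hA : 0 < A) (hγ : 1 < γ) (hτ : 0 < τ) (hζ : 0 < ζ)
    (hη : ContDiffOn ℝ 1 (fun p : ℝ × Tensor => η p.1 p.2) (Ioi 0 ×ˢ univ))
    (hρbar : 0 < ρbar) (hηbar : 0 < η ρbar 0) {R : ℝ}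
    (hρ0 : ∀ x, R ≤ ‖x‖ → ρ 0 x = ρbar) (hv0 : ∀ x, R ≤ ‖x‖ → v 0 x = 0)
    (hS0 : ∀ x, R ≤ ‖x‖ → S 0 x = 0) {t : ℝ} (ht : t ∈ Icc 0 T) {x : Space}
    (hx : R + frontSpeed A γ τ ζ η ρbar * t ≤ ‖x‖) :
    ρ t x = ρbar ∧ v t x = 0 ∧ S t x = 0 := by
  rcases ht.1.eq_or_lt with rfl | ht0
  · have hR : R ≤ ‖x‖ := by simpa using hx
    exact ⟨hρ0 x hR, hv0 x hR, hS0 x hR⟩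
  have hc2 := soundSpeed_sq_pos hA hγ hρbar
  have hσ := frontSpeed_pos (A := A) (γ := γ) hτ hζ hρbar hηbar
  set c2 := soundSpeed A γ ρbar ^ 2 with hc2def
  set σ := frontSpeed A γ τ ζ η ρbar with hσdef
  have hE0 := linEnergy_nonneg hc2 hρbar hηbar hτ hζ
  have hu : C1Slab T fun s y => linEnergy c2 ρbar (η ρbar 0) τ ζ (ρ s y - ρbar) (v s y).ofLp
      (S s y) := h.c1Slab_linEnergy c2 (η ρbar 0)
  have hinit : ∀ y, linEnergy c2 ρbar (η ρbar 0) τ ζ (ρ 0 y - ρbar) (v 0 y).ofLp (S 0 y)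
      * coneCutoff σ t x 0 y = 0 := by
    intro y
    rcases le_or_gt (σ * |t - 0|) ‖y - x‖ with hy | hy
    · rw [coneCutoff_eq_zero hy hσ.le, mul_zero]
    · rw [sub_zero, abs_of_pos ht0] at hy
      have hRy : R ≤ ‖y‖ := by
        have := norm_sub_norm_le x y
        rw [norm_sub_rev] at this
        linarith
      rw [hρ0 y hRy, hv0 y hRy, hS0 y hRy]
      simp [linEnergy]
  have hzero : ∀ s ∈ Ioo 0 t, linEnergy c2 ρbar (η ρbar 0) τ ζ (ρ s x - ρbar) (v s x).ofLp
      (S s x) = 0 := by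
    intro s hs
    have hsT : s ∈ Icc 0 T := ⟨hs.1.le, hs.2.le.trans ht.2⟩
    have hle := h.integral_energy_cone_nonpos hA hγ hτ hζ hη hρbar hηbar ht0 ht.2 x hinit
      (Ioo_subset_Icc_self hs)
    rw [← hc2def, ← hσdef] at hle
    have hcont : Continuous fun y => linEnergy c2 ρbar (η ρbar 0) τ ζ (ρ s y - ρbar) (v s y).ofLp
        (S s y) * coneCutoff σ t x s y :=
      (hu.continuous_slice hsT).mul (C1Slab.continuous_slice (c1Slab_coneCutoff T) hsT)
    have hnn : ∀ y, 0 ≤ linEnergy c2 ρbar (η ρbar 0) τ ζ (ρ s y - ρbar) (v s y).ofLp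
        (S s y) * coneCutoff σ t x s y := fun y => mul_nonneg (hE0 _ _ _) (coneCutoff_nonneg _ _)
    have hsupp : HasCompactSupport fun y => linEnergy c2 ρbar (η ρbar 0) τ ζ (ρ s y - ρbar)
        (v s y).ofLp (S s y) * coneCutoff σ t x s y := by
      refine hasCompactSupport_of_notMem (isCompact_closedBall x (σ * |t - s|)) fun y hy => ?_
      rw [Metric.mem_closedBall, not_le, dist_eq_norm] at hy
      rw [coneCutoff_eq_zero hy.le hσ.le, mul_zero]
    have hae := (integral_eq_zero_iff_of_nonneg hnn
      (hcont.integrable_of_hasCompactSupport hsupp)).1 (le_antisymm hle (integral_nonneg hnn))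
    have := congrFun ((hcont.ae_eq_iff_eq volume continuous_const).1 hae) x
    exact (mul_eq_zero.1 this).resolve_right (coneCutoff_apex_pos hσ hs.2).ne'
  have hlim : linEnergy c2 ρbar (η ρbar 0) τ ζ (ρ t x - ρbar) (v t x).ofLp (S t x) = 0 := by
    have h1 : Tendsto (fun s => linEnergy c2 ρbar (η ρbar 0) τ ζ (ρ s x - ρbar) (v s x).ofLp
        (S s x)) (𝓝[Ioo 0 t] t) (𝓝 _) :=
      ((hu.continuousOn_time x) t ht).mono_left
        (nhdsWithin_mono t fun s hs => ⟨hs.1.le, hs.2.le.trans ht.2⟩)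
    have : (𝓝[Ioo 0 t] t).NeBot := by
      rw [← mem_closure_iff_nhdsWithin_neBot, closure_Ioo ht0.ne]
      exact right_mem_Icc.2 ht0.le
    refine tendsto_nhds_unique h1 (tendsto_const_nhds.congr' ?_)
    filter_upwards [self_mem_nhdsWithin] with s hs using (hzero s hs).symm
  obtain ⟨C, -, hC⟩ := exists_sqSize_le hc2 hρbar hηbar hτ hζ
  have hsz := hC (ρ t x - ρbar) (v t x).ofLp (S t x)
  rw [hlim, mul_zero] at hsz
  obtain ⟨z1, z2, z3⟩ := sqSize_eq_zero hsz
  refine ⟨sub_eq_zero.1 z1, ?_, ?_⟩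
  · ext i; exact z2 i
  · ext i j; exact z3 i j

end IsC1Solution

/-! ### Balance laws of mass, stress trace and radial momentum -/

/-- The pressure lies above its tangent at equilibrium. -/
lemma soundSpeed_sq_mul_le_pressure_sub {A γ r ρbar : ℝ} (hA : 0 < A) (hγ : 1 < γ) (hr : 0 < r)
    (hρbar : 0 < ρbar) :
    soundSpeed A γ ρbar ^ 2 * (r - ρbar) ≤ pressure A γ r - pressure A γ ρbar := by
  have hb := one_add_mul_self_le_rpow_one_add (s := r / ρbar - 1)
    (by have : 0 < r / ρbar := by positivity
        linarith) hγ.le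
  have hpos : 0 < ρbar ^ γ := Real.rpow_pos_of_pos hρbar γ
  rw [add_sub_cancel, Real.div_rpow hr.le hρbar.le, le_div_iff₀ hpos] at hb
  rw [soundSpeed_sq hA hγ hρbar, Real.rpow_sub_one hρbar.ne', pressure, pressure]
  have h1 : A * (γ * (ρbar ^ γ / ρbar)) * (r - ρbar)
      = A * ((1 + γ * (r / ρbar - 1)) * ρbar ^ γ - ρbar ^ γ) := by
    field_simp; ring
  rw [h1, ← mul_sub]
  exact mul_le_mul_of_nonneg_left (by linarith) hA.le

namespace IsC1Solution

variable {A γ τ ζ : ℝ} {η : ℝ → Tensor → ℝ} {T : ℝ} {ρ : ℝ → Space → ℝ}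
  {v : ℝ → Space → Space} {S : ℝ → Space → Tensor} {ρbar : ℝ} {K : Set Space}

lemma c1Slab_density_sub (h : IsC1Solution A γ τ ζ η T ρ v S) :
    C1Slab T fun t x => ρ t x - ρbar :=
  ContDiffOn.sub h.c1Slab_density contDiffOn_const

lemma c1Slab_trace (h : IsC1Solution A γ τ ζ η T ρ v S) :
    C1Slab T fun t x => ∑ i, S t x i i :=
  ContDiffOn.sum fun i _ => h.c1Slab_stress i i

lemma c1Slab_radialMomentum (h : IsC1Solution A γ τ ζ η T ρ v S) :
    C1Slab T fun t x => ∑ i, x i * ρ t x * v t x i := by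
  have hr := h.c1Slab_density
  have hw := h.c1Slab_velocity
  unfold C1Slab at *
  fun_prop

/-- The relative mass is conserved. -/
lemma hasDerivAt_relativeMass (h : IsC1Solution A γ τ ζ η T ρ v S) (hK : IsCompact K)
    (hρ : ∀ t ∈ Icc 0 T, ∀ x ∉ K, ρ t x = ρbar) (hv : ∀ t ∈ Icc 0 T, ∀ x ∉ K, v t x = 0)
    {t : ℝ} (ht : t ∈ Ioo 0 T) :
    HasDerivAt (fun t => relativeMass ρbar (ρ t)) 0 t := by
  have ht' := Ioo_subset_Icc_self ht
  have hr := h.c1Slab_density.contDiff_slice ht'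
  have hw k := (h.c1Slab_velocity k).contDiff_slice ht'
  have := (h.c1Slab_density_sub (ρbar := ρbar)).hasDerivAt_integral_of_balance hK
    (fun t ht x hx => by rw [hρ t ht x hx, sub_self]) ht
    (h := fun k y => ρ t y * v t y k) (fun k => hr.mul (hw k))
    (fun k x hx => by rw [hv t ht' x hx]; simp) (s := fun _ => 0) fun x => by
      rw [timeDeriv_eq_deriv ht, ((h.c1Slab_density.hasDerivAt_time ht x).sub_const ρbar).deriv]
      have hp k := partialDeriv_mul (k := k) (hr.differentiable one_ne_zero x)
        ((hw k).differentiable one_ne_zero x)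
      simp only [hp]
      rw [← h.timeDeriv_density ht' x, Finset.sum_add_distrib, Finset.mul_sum]
      ring
  simpa [relativeMass] using this.2

/-- The shear viscosity drops out of the trace of the relaxation equation, so that the integrated
trace of the stress decays exponentially. -/
lemma hasDerivAt_totalTrace (h : IsC1Solution A γ τ ζ η T ρ v S) (hτ : 0 < τ) (hK : IsCompact K)
    (hv : ∀ t ∈ Icc 0 T, ∀ x ∉ K, v t x = 0) (hS : ∀ t ∈ Icc 0 T, ∀ x ∉ K, S t x = 0)
    {t : ℝ} (ht : t ∈ Ioo 0 T) :
    HasDerivAt (fun t => totalTrace (S t)) (-1 / τ * totalTrace (S t)) t := by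
  have ht' := Ioo_subset_Icc_self ht
  have htr := h.c1Slab_trace.contDiff_slice ht'
  have hw k := (h.c1Slab_velocity k).contDiff_slice ht'
  have := h.c1Slab_trace.hasDerivAt_integral_of_balance hK
    (fun t ht x hx => by simp [hS t ht x hx]) ht
    (h := fun k y => v t y k * (3 * ζ / τ + ∑ i, S t y i i))
    (fun k => (hw k).mul (contDiff_const.add htr))
    (fun k x hx => by rw [hv t ht' x hx]; simp) (s := fun x => -1 / τ * ∑ i, S t x i i) fun x => by
      have hP i j := (h.c1Slab_stress i j).differentiableAt_slice ht' x
      rw [timeDeriv_eq_deriv ht, (HasDerivAt.fun_sum (u := Finset.univ) fun i _ =>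
        (h.c1Slab_stress i i).hasDerivAt_time ht x).deriv]
      have hp k := partialDeriv_mul (k := k) (g := fun y => 3 * ζ / τ + ∑ i, S t y i i)
        ((hw k).differentiable one_ne_zero x)
        ((contDiff_const.add htr).differentiable one_ne_zero x)
      have hq k : partialDeriv k (fun y => 3 * ζ / τ + ∑ i, S t y i i) x
          = ∑ i, partialDeriv k (fun y => S t y i i) x := by
        rw [partialDeriv_add (by fun_prop) (by fun_prop), partialDeriv_const, zero_add,
          partialDeriv_sum fun i _ => hP i i]
      simp only [hp, hq]
      have e i := h.timeDeriv_stress ht' x i i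
      have e0 := e 0
      have e1 := e 1
      have e2 := e 2
      simp only [Fin.sum_univ_three, if_true] at e0 e1 e2 ⊢
      field_simp
      linarith
  rw [totalTrace, ← integral_const_mul]
  exact this.2

/-- The virial identity. -/
lemma hasDerivAt_radialMomentum (h : IsC1Solution A γ τ ζ η T ρ v S) (hA : 0 < A) (hγ : 1 < γ)
    (hK : IsCompact K)
    (hρ : ∀ t ∈ Icc 0 T, ∀ x ∉ K, ρ t x = ρbar) (hv : ∀ t ∈ Icc 0 T, ∀ x ∉ K, v t x = 0)
    (hS : ∀ t ∈ Icc 0 T, ∀ x ∉ K, S t x = 0) {t : ℝ} (ht : t ∈ Ioo 0 T) :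
    Integrable (fun x => ρ t x * ∑ i, v t x i ^ 2
      + 3 * (pressure A γ (ρ t x) - pressure A γ ρbar) + ∑ i, S t x i i) ∧
    HasDerivAt (fun t => radialMomentum (ρ t) (v t))
      (∫ x, (ρ t x * ∑ i, v t x i ^ 2 + 3 * (pressure A γ (ρ t x) - pressure A γ ρbar)
        + ∑ i, S t x i i)) t := by
  have ht' := Ioo_subset_Icc_self ht
  have hr := h.c1Slab_density.contDiff_slice ht'
  have hw k := (h.c1Slab_velocity k).contDiff_slice ht'
  have hP i j := (h.c1Slab_stress i j).contDiff_slice ht'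
  have hp : ContDiff ℝ 1 fun x => pressure A γ (ρ t x) := by
    rw [contDiff_iff_contDiffAt]
    exact fun x => contDiffAt_const.mul
      ((Real.contDiffAt_rpow_const_of_ne (h.density_pos t ht' x).ne').comp x hr.contDiffAt)
  refine h.c1Slab_radialMomentum.hasDerivAt_integral_of_balance hK
    (fun t ht x hx => by simp [hv t ht x hx]) ht
    (h := fun k y => ∑ i, y i * (ρ t y * (v t y k * v t y i) + S t y i k)
      + y k * (pressure A γ (ρ t y) - pressure A γ ρbar)) (fun k => by fun_prop)
    (fun k x hx => by rw [hv t ht' x hx, hρ t ht' x hx, hS t ht' x hx]; simp) fun x => ?_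
  have hr1 := hr.differentiable one_ne_zero x
  have hw1 i := (hw i).differentiable one_ne_zero x
  have hP1 i j := (hP i j).differentiable one_ne_zero x
  have hp1 := hp.differentiable one_ne_zero x
  have hx1 (i : Fin 3) : DifferentiableAt ℝ (fun y : Space => y i) x := by fun_prop
  rw [timeDeriv_eq_deriv ht, (HasDerivAt.fun_sum (u := Finset.univ) fun i _ =>
    ((h.c1Slab_density.hasDerivAt_time ht x).const_mul (x i)).fun_mul
      ((h.c1Slab_velocity i).hasDerivAt_time ht x)).deriv]
  have hq k : partialDeriv k (fun y => pressure A γ (ρ t y) - pressure A γ ρbar) x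
      = soundSpeed A γ (ρ t x) ^ 2 * partialDeriv k (ρ t) x := by
    have hpos := h.density_pos t ht' x
    rw [soundSpeed_sq hA hγ hpos]
    exact partialDeriv_comp (φ := fun z => pressure A γ z - pressure A γ ρbar)
      ((hasDerivAt_pressure A hpos).sub_const _) hr1
  have hq2 k i : partialDeriv k (fun y => y i * (ρ t y * (v t y k * v t y i) + S t y i k)) x
      = x i * (ρ t x * (v t x k * partialDeriv k (fun y => v t y i) x
          + v t x i * partialDeriv k (fun y => v t y k) x)
          + v t x k * v t x i * partialDeriv k (ρ t) x + partialDeriv k (fun y => S t y i k) x)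
        + (ρ t x * (v t x k * v t x i) + S t x i k) * (if i = k then 1 else 0) := by
    rw [partialDeriv_mul (hx1 i) (by fun_prop), partialDeriv_coord,
      partialDeriv_add (by fun_prop) (hP1 i k), partialDeriv_mul hr1 (by fun_prop),
      partialDeriv_mul (hw1 k) (hw1 i)]
  have hq3 k : partialDeriv k (fun y => ∑ i, y i * (ρ t y * (v t y k * v t y i) + S t y i k)
      + y k * (pressure A γ (ρ t y) - pressure A γ ρbar)) x
      = ∑ i, partialDeriv k (fun y => y i * (ρ t y * (v t y k * v t y i) + S t y i k)) x
        + (x k * (soundSpeed A γ (ρ t x) ^ 2 * partialDeriv k (ρ t) x)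
          + (pressure A γ (ρ t x) - pressure A γ ρbar)) := by
    rw [partialDeriv_add (by fun_prop) (by fun_prop), partialDeriv_sum fun i _ => by fun_prop,
      partialDeriv_mul (hx1 k) (by fun_prop), partialDeriv_coord, hq]
    simp
  simp only [hq3, hq2]
  have e1 := h.timeDeriv_density ht' x
  have e2 := h.timeDeriv_velocity hA hγ ht' x
  have e20 := e2 0
  have e21 := e2 1
  have e22 := e2 2
  simp only [Fin.sum_univ_three] at e1 e20 e21 e22 ⊢
  simp only [Fin.isValue, Fin.reduceEq, if_true, if_false]
  linear_combination x 0 * (v t x 0 * e1 + e20) + x 1 * (v t x 1 * e1 + e21)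
    + x 2 * (v t x 2 * e1 + e22)

end IsC1Solution

/-! ### The virial inequality and blow-up -/

lemma volume_real_closedBall {r : ℝ} (hr : 0 ≤ r) :
    volume.real (Metric.closedBall (0 : Space) r) = 4 * Real.pi / 3 * r ^ 3 := by
  rw [Measure.real, EuclideanSpace.volume_closedBall_fin_three, ENNReal.toReal_mul,
    ENNReal.toReal_pow, ENNReal.toReal_ofReal hr, ENNReal.toReal_ofReal (by positivity)]
  ring

lemma relativeMass_le {ρbar R ρmax : ℝ} {r : Space → ℝ} (hR : 0 ≤ R) (hle : ∀ x, r x ≤ ρmax)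
    (hout : ∀ x, R ≤ ‖x‖ → r x = ρbar) (hint : Integrable fun x => r x - ρbar) :
    relativeMass ρbar r ≤ (ρmax - ρbar) * (4 * Real.pi / 3 * R ^ 3) := by
  have hi : Integrable ((Metric.closedBall (0 : Space) R).indicator fun _ => ρmax - ρbar) :=
    (integrable_indicator_iff Metric.isClosed_closedBall.measurableSet).2
      (integrableOn_const (isCompact_closedBall _ _).measure_ne_top)
  refine (integral_mono hint hi fun x => ?_).trans_eq ?_
  · by_cases hx : x ∈ Metric.closedBall (0 : Space) R
    · rw [indicator_of_mem hx]; linarith [hle x]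
    · rw [indicator_of_notMem hx]
      rw [mem_closedBall_zero_iff, not_le] at hx
      rw [hout x hx.le, sub_self]
  · rw [integral_indicator_const _ Metric.isClosed_closedBall.measurableSet,
      volume_real_closedBall hR, smul_eq_mul, mul_comm]

/-- A function with `F' ≥ F² / (κ (R + σt)⁵)` and sufficiently large initial value blows up in
finite time, since `∫ (R + σt)⁻⁵ dt` converges. -/
lemma time_le_of_riccati {F d : ℝ → ℝ} {T κ σ R : ℝ} (hT : 0 < T) (hκ : 0 < κ) (hσ : 0 < σ)
    (hR : 0 < R) (hF : ContinuousOn F (Icc 0 T))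
    (hd : ∀ t ∈ Ioo 0 T, HasDerivAt F (d t) t ∧ F t ^ 2 ≤ κ * (R + σ * t) ^ 5 * d t)
    (hF0 : 4 * κ * σ * R ^ 4 < F 0) :
    T ≤ 1 / (4 * R ^ 3 * σ * (1 / R ^ 4 - 4 * κ * σ / F 0)) := by
  have hF0pos : 0 < F 0 := lt_trans (by positivity) hF0
  have hrpos : ∀ t ∈ Icc 0 T, 0 < R + σ * t := fun t ht => by
    have := mul_nonneg hσ.le ht.1; linarith
  have hmono : MonotoneOn F (Icc 0 T) := by
    refine monotoneOn_of_deriv_nonneg (convex_Icc 0 T) hF ?_ ?_ <;> rw [interior_Icc]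
    · exact fun t ht => (hd t ht).1.differentiableAt.differentiableWithinAt
    · intro t ht
      rw [(hd t ht).1.deriv]
      have := hrpos t (Ioo_subset_Icc_self ht)
      exact nonneg_of_mul_nonneg_right ((sq_nonneg _).trans (hd t ht).2) (by positivity)
  have hpos : ∀ t ∈ Icc 0 T, 0 < F t := fun t ht =>
    hF0pos.trans_le (hmono (left_mem_Icc.2 hT.le) ht ht.1)
  have hcont : ContinuousOn (fun t => 4 * κ * σ * (F t)⁻¹ - ((R + σ * t) ^ 4)⁻¹) (Icc 0 T) := by
    refine (continuousOn_const.mul (hF.inv₀ fun t ht => (hpos t ht).ne')).sub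
      (ContinuousOn.inv₀ (by fun_prop) fun t ht => (pow_pos (hrpos t ht) 4).ne')
  have hder : ∀ t ∈ Ioo 0 T, HasDerivAt (fun t => 4 * κ * σ * (F t)⁻¹ - ((R + σ * t) ^ 4)⁻¹)
      (4 * κ * σ * (-d t / F t ^ 2) - (-(4 * (R + σ * t) ^ 3 * σ)) / ((R + σ * t) ^ 4) ^ 2) t := by
    intro t ht
    have ht' := Ioo_subset_Icc_self ht
    have h1 : HasDerivAt (fun t => (R + σ * t) ^ 4) (4 * (R + σ * t) ^ 3 * σ) t :=
      ((((hasDerivAt_id t).const_mul σ).const_add R).fun_pow 4).congr_deriv (by simp)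
    exact (((hd t ht).1.fun_inv (hpos t ht').ne').const_mul _).fun_sub
      (h1.fun_inv (pow_pos (hrpos t ht') 4).ne')
  have hanti : AntitoneOn (fun t => 4 * κ * σ * (F t)⁻¹ - ((R + σ * t) ^ 4)⁻¹) (Icc 0 T) := by
    refine antitoneOn_of_deriv_nonpos (convex_Icc 0 T) hcont ?_ ?_ <;> rw [interior_Icc]
    · exact fun t ht => (hder t ht).differentiableAt.differentiableWithinAt
    · intro t ht
      rw [(hder t ht).deriv]
      have ht' := Ioo_subset_Icc_self ht
      have hr := hrpos t ht'
      have hFt := hpos t ht'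
      have h1 : 4 * κ * σ * (-d t / F t ^ 2)
          - (-(4 * (R + σ * t) ^ 3 * σ)) / ((R + σ * t) ^ 4) ^ 2
          = 4 * σ * (F t ^ 2 - κ * (R + σ * t) ^ 5 * d t) / (F t ^ 2 * (R + σ * t) ^ 5) := by
        field_simp; ring
      rw [h1]
      refine div_nonpos_of_nonpos_of_nonneg (mul_nonpos_of_nonneg_of_nonpos (by positivity) ?_)
        (by positivity)
      linarith [(hd t ht).2]
  have hend := hanti (left_mem_Icc.2 hT.le) (right_mem_Icc.2 hT.le) hT.le
  simp only [mul_zero, add_zero] at hend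
  have hFT : 0 < 4 * κ * σ * (F T)⁻¹ := by
    have := hpos T (right_mem_Icc.2 hT.le); positivity
  have hδ : 0 < 1 / R ^ 4 - 4 * κ * σ / F 0 := by
    rw [sub_pos, div_lt_div_iff₀ hF0pos (by positivity)]; linarith
  have hrT := hrpos T (right_mem_Icc.2 hT.le)
  have h4 : (1 / R ^ 4 - 4 * κ * σ / F 0) * (R + σ * T) ^ 4 ≤ 1 := by
    rw [← le_div_iff₀ (by positivity), one_div, one_div, div_eq_mul_inv]
    linarith
  have h5 : 4 * R ^ 3 * σ * T ≤ (R + σ * T) ^ 4 := by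
    have h : (R + σ * T) ^ 4 - 4 * R ^ 3 * σ * T
        = R ^ 4 + 6 * R ^ 2 * (σ * T) ^ 2 + 4 * R * (σ * T) ^ 3 + (σ * T) ^ 4 := by ring
    have : 0 ≤ R ^ 4 + 6 * R ^ 2 * (σ * T) ^ 2 + 4 * R * (σ * T) ^ 3 + (σ * T) ^ 4 := by
      positivity
    linarith
  rw [le_div_iff₀ (by positivity)]
  calc T * (4 * R ^ 3 * σ * (1 / R ^ 4 - 4 * κ * σ / F 0))
      = (1 / R ^ 4 - 4 * κ * σ / F 0) * (4 * R ^ 3 * σ * T) := by ring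
    _ ≤ (1 / R ^ 4 - 4 * κ * σ / F 0) * (R + σ * T) ^ 4 := by gcongr
    _ ≤ 1 := h4

/-- The lower bound `F' ≥ 2 λ F - λ² I` for every `λ`, where `I` bounds the moment of inertia of
the disturbed region. -/
lemma virial_lower_bound {A γ ρbar ρmax l r : ℝ} {ρ : Space → ℝ} {v : Space → Space}
    {S : Space → Tensor} (hA : 0 < A) (hγ : 1 < γ) (hρbar : 0 < ρbar) (hr : 0 ≤ r)
    (hpos : ∀ x, 0 < ρ x) (hρ : ∀ x, r ≤ ‖x‖ → ρ x = ρbar) (hv : ∀ x, r ≤ ‖x‖ → v x = 0)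
    (hM : 0 ≤ relativeMass ρbar ρ)
    (hM' : relativeMass ρbar ρ ≤ (ρmax - ρbar) * (4 * Real.pi / 3 * r ^ 3))
    (hG : 0 ≤ totalTrace S)
    (hi : Integrable fun x => ρ x * ∑ i, v x i ^ 2
      + 3 * (pressure A γ (ρ x) - pressure A γ ρbar) + ∑ i, S x i i)
    (hiM : Integrable fun x => ρ x - ρbar) (hiF : Integrable fun x => ∑ i, x i * ρ x * v x i)
    (hiG : Integrable fun x => ∑ i, S x i i) :
    2 * l * radialMomentum ρ v - l ^ 2 * (4 * Real.pi / 3 * ρmax * r ^ 5)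
      ≤ ∫ x, (ρ x * ∑ i, v x i ^ 2 + 3 * (pressure A γ (ρ x) - pressure A γ ρbar)
        + ∑ i, S x i i) := by
  set B := Metric.closedBall (0 : Space) r with hB
  have hBm : MeasurableSet B := Metric.isClosed_closedBall.measurableSet
  have hiB : Integrable (B.indicator fun _ => ρbar) :=
    (integrable_indicator_iff hBm).2 (integrableOn_const (isCompact_closedBall _ _).measure_ne_top)
  have hc := soundSpeed_sq_pos hA hγ hρbar
  -- off the ball `B` the density is `ρ̄`, so `ρ - ρ̄ + ρ̄ 1_B` is the density restricted to `B`
  have hle : ∀ x, 2 * l * (∑ i, x i * ρ x * v x i)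
      - l ^ 2 * r ^ 2 * ((ρ x - ρbar) + B.indicator (fun _ => ρbar) x)
      + 3 * soundSpeed A γ ρbar ^ 2 * (ρ x - ρbar) + ∑ i, S x i i
      ≤ ρ x * ∑ i, v x i ^ 2 + 3 * (pressure A γ (ρ x) - pressure A γ ρbar) + ∑ i, S x i i := by
    intro x
    have hp := soundSpeed_sq_mul_le_pressure_sub hA hγ (hpos x) hρbar
    by_cases hx : x ∈ B
    · rw [indicator_of_mem hx]
      have hx' : ∑ i, x i ^ 2 ≤ r ^ 2 := by
        rw [← EuclideanSpace.real_norm_sq_eq]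
        exact pow_le_pow_left₀ (norm_nonneg _) (mem_closedBall_zero_iff.1 hx) 2
      have h1 : 0 ≤ ρ x * ∑ i, (v x i - l * x i) ^ 2 :=
        mul_nonneg (hpos x).le (Finset.sum_nonneg fun i _ => sq_nonneg _)
      have h2 : l ^ 2 * ρ x * ∑ i, x i ^ 2 ≤ l ^ 2 * ρ x * r ^ 2 :=
        mul_le_mul_of_nonneg_left hx' (mul_nonneg (sq_nonneg _) (hpos x).le)
      simp only [Fin.sum_univ_three] at h1 h2 ⊢
      linarith
    · rw [indicator_of_notMem hx]
      rw [hB, mem_closedBall_zero_iff, not_le] at hx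
      rw [hρ x hx.le, hv x hx.le]
      simp
  have i1 : Integrable fun x => 2 * l * ∑ i, x i * ρ x * v x i := hiF.const_mul _
  have i2 : Integrable fun x => l ^ 2 * r ^ 2 * ((ρ x - ρbar) + B.indicator (fun _ => ρbar) x) :=
    (hiM.add hiB).const_mul _
  have i3 : Integrable fun x => 3 * soundSpeed A γ ρbar ^ 2 * (ρ x - ρbar) := hiM.const_mul _
  have i12 : Integrable fun x => 2 * l * (∑ i, x i * ρ x * v x i)
      - l ^ 2 * r ^ 2 * ((ρ x - ρbar) + B.indicator (fun _ => ρbar) x) := i1.sub i2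
  have i123 : Integrable fun x => 2 * l * (∑ i, x i * ρ x * v x i)
      - l ^ 2 * r ^ 2 * ((ρ x - ρbar) + B.indicator (fun _ => ρbar) x)
      + 3 * soundSpeed A γ ρbar ^ 2 * (ρ x - ρbar) := i12.add i3
  have hint : ∫ x, (2 * l * (∑ i, x i * ρ x * v x i)
      - l ^ 2 * r ^ 2 * ((ρ x - ρbar) + B.indicator (fun _ => ρbar) x)
      + 3 * soundSpeed A γ ρbar ^ 2 * (ρ x - ρbar) + ∑ i, S x i i)
      = 2 * l * radialMomentum ρ v
        - l ^ 2 * r ^ 2 * (relativeMass ρbar ρ + ρbar * (4 * Real.pi / 3 * r ^ 3))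
        + 3 * soundSpeed A γ ρbar ^ 2 * relativeMass ρbar ρ + totalTrace S := by
    rw [integral_add i123 hiG, integral_add i12 i3, integral_sub i1 i2, integral_const_mul,
      integral_const_mul, integral_const_mul, integral_add hiM hiB,
      integral_indicator_const _ hBm, hB, volume_real_closedBall hr, smul_eq_mul]
    simp only [radialMomentum, relativeMass, totalTrace]
    ring
  have hmono := integral_mono (i123.add hiG) hi hle
  have h3 : l ^ 2 * r ^ 2 * (relativeMass ρbar ρ + ρbar * (4 * Real.pi / 3 * r ^ 3))
      ≤ l ^ 2 * r ^ 2 * (ρmax * (4 * Real.pi / 3 * r ^ 3)) := by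
    refine mul_le_mul_of_nonneg_left ?_ (by positivity); linarith
  have h4 : 0 ≤ 3 * soundSpeed A γ ρbar ^ 2 * relativeMass ρbar ρ := by positivity
  refine le_trans ?_ hmono
  refine le_trans ?_ hint.ge
  linarith

/-- Upper bound for the time of existence. -/
theorem IsC1Solution.time_le {A γ τ ζ : ℝ} {η : ℝ → Tensor → ℝ} {T : ℝ} {ρ : ℝ → Space → ℝ}
    {v : ℝ → Space → Space} {S : ℝ → Space → Tensor} {ρbar R ρmax : ℝ}
    (h : IsC1Solution A γ τ ζ η T ρ v S) (hT : 0 < T)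
    (hA : 0 < A) (hγ : 1 < γ) (hτ : 0 < τ) (hζ : 0 < ζ)
    (hη : ContDiffOn ℝ 1 (fun p : ℝ × Tensor => η p.1 p.2) (Ioi 0 ×ˢ univ))
    (hρbar : 0 < ρbar) (hR : 0 < R) (hηbar : 0 < η ρbar 0)
    (hρ0 : ∀ x, R ≤ ‖x‖ → ρ 0 x = ρbar) (hv0 : ∀ x, R ≤ ‖x‖ → v 0 x = 0)
    (hS0 : ∀ x, R ≤ ‖x‖ → S 0 x = 0) (hmax : ∀ x, ρ 0 x ≤ ρmax)
    (hM : 0 ≤ relativeMass ρbar (ρ 0))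
    (hF : 4 * (4 * Real.pi / 3 * ρmax) * frontSpeed A γ τ ζ η ρbar * R ^ 4
      < radialMomentum (ρ 0) (v 0))
    (hG : 0 ≤ totalTrace (S 0)) :
    T ≤ 1 / (4 * R ^ 3 * frontSpeed A γ τ ζ η ρbar * (1 / R ^ 4
      - 4 * (4 * Real.pi / 3 * ρmax) * frontSpeed A γ τ ζ η ρbar
        / radialMomentum (ρ 0) (v 0))) := by
  have hσ := frontSpeed_pos (A := A) (γ := γ) hτ hζ hρbar hηbar
  have hprop {t : ℝ} (ht : t ∈ Icc 0 T) {x : Space}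
      (hx : R + frontSpeed A γ τ ζ η ρbar * t ≤ ‖x‖) : ρ t x = ρbar ∧ v t x = 0 ∧ S t x = 0 :=
    h.eq_equilibrium_of_le_norm hA hγ hτ hζ hη hρbar hηbar hρ0 hv0 hS0 ht hx
  set σ := frontSpeed A γ τ ζ η ρbar
  have hρmax : ρbar ≤ ρmax := by
    rw [← hρ0 (EuclideanSpace.single 0 R) (by simp [abs_of_pos hR])]
    exact hmax _
  have hρmax0 : 0 < ρmax := hρbar.trans_le hρmax
  have hK : IsCompact (Metric.closedBall (0 : Space) (R + σ * T)) := isCompact_closedBall _ _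
  set K := Metric.closedBall (0 : Space) (R + σ * T) with hKdef
  have hout : ∀ t ∈ Icc 0 T, ∀ x ∉ K, ρ t x = ρbar ∧ v t x = 0 ∧ S t x = 0 := by
    intro t ht x hx
    rw [hKdef, mem_closedBall_zero_iff, not_le] at hx
    have := mul_le_mul_of_nonneg_left ht.2 hσ.le
    exact hprop ht (by linarith)
  have hKρ : ∀ t ∈ Icc 0 T, ∀ x ∉ K, ρ t x = ρbar := fun t ht x hx => (hout t ht x hx).1
  have hKv : ∀ t ∈ Icc 0 T, ∀ x ∉ K, v t x = 0 := fun t ht x hx => (hout t ht x hx).2.1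
  have hKS : ∀ t ∈ Icc 0 T, ∀ x ∉ K, S t x = 0 := fun t ht x hx => (hout t ht x hx).2.2
  have hM0 : ∀ t ∈ Icc 0 T, ∀ x ∉ K, ρ t x - ρbar = 0 := fun t ht x hx => by
    rw [hKρ t ht x hx, sub_self]
  have hF0 : ∀ t ∈ Icc 0 T, ∀ x ∉ K, ∑ i, x i * ρ t x * v t x i = 0 := fun t ht x hx => by
    simp [hKv t ht x hx]
  have hG0 : ∀ t ∈ Icc 0 T, ∀ x ∉ K, ∑ i, S t x i i = 0 := fun t ht x hx => by
    simp [hKS t ht x hx]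
  have hMc : ContinuousOn (fun t => relativeMass ρbar (ρ t)) (Icc 0 T) :=
    h.c1Slab_density_sub.continuousOn_integral hK hM0
  have hFc : ContinuousOn (fun t => radialMomentum (ρ t) (v t)) (Icc 0 T) :=
    h.c1Slab_radialMomentum.continuousOn_integral hK hF0
  have hGc : ContinuousOn (fun t => totalTrace (S t)) (Icc 0 T) :=
    h.c1Slab_trace.continuousOn_integral hK hG0
  have hMd t (ht : t ∈ Ioo 0 T) := h.hasDerivAt_relativeMass hK hKρ hKv ht
  have hGd t (ht : t ∈ Ioo 0 T) := h.hasDerivAt_totalTrace hτ hK hKv hKS ht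
  have hMle : ∀ t ∈ Icc 0 T, relativeMass ρbar (ρ t) ≤ relativeMass ρbar (ρ 0) := fun t ht =>
    sub_nonpos.1 (nonpos_of_hasDerivAt_le (C := 0) (f' := fun _ => 0)
      (f := fun t => relativeMass ρbar (ρ t) - relativeMass ρbar (ρ 0))
      (hMc.sub continuousOn_const) (fun t ht => ⟨(hMd t ht).sub_const _, by simp⟩) (by simp) ht)
  have hMge : ∀ t ∈ Icc 0 T, relativeMass ρbar (ρ 0) ≤ relativeMass ρbar (ρ t) := fun t ht =>
    sub_nonpos.1 (nonpos_of_hasDerivAt_le (C := 0) (f' := fun _ => 0)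
      (f := fun t => relativeMass ρbar (ρ 0) - relativeMass ρbar (ρ t))
      (continuousOn_const.sub hMc)
      (fun t ht => ⟨by simpa using (hMd t ht).const_sub _, by simp⟩) (by simp) ht)
  have hGnn : ∀ t ∈ Icc 0 T, 0 ≤ totalTrace (S t) := fun t ht =>
    neg_nonpos.1 (nonpos_of_hasDerivAt_le (C := -1 / τ) (f := fun t => -totalTrace (S t))
      hGc.neg (fun t ht => ⟨(hGd t ht).fun_neg, by simp⟩) (by simpa using hG) ht)
  have h0 : (0 : ℝ) ∈ Icc 0 T := left_mem_Icc.2 hT.le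
  have hM1 := relativeMass_le hR.le hmax hρ0 (h.c1Slab_density_sub.integrable_slice hK hM0 h0)
  refine time_le_of_riccati (κ := 4 * Real.pi / 3 * ρmax) hT (by positivity) hσ hR hFc
    (d := fun t => ∫ x, (ρ t x * ∑ i, v t x i ^ 2
      + 3 * (pressure A γ (ρ t x) - pressure A γ ρbar) + ∑ i, S t x i i)) (fun t ht => ?_) hF
  obtain ⟨hi, hd⟩ := h.hasDerivAt_radialMomentum hA hγ hK hKρ hKv hKS ht
  refine ⟨hd, ?_⟩
  have ht' := Ioo_subset_Icc_self ht
  have hσt : 0 ≤ σ * t := mul_nonneg hσ.le ht'.1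
  have hr : 0 < R + σ * t := by linarith
  have hI : 0 < 4 * Real.pi / 3 * ρmax * (R + σ * t) ^ 5 := by positivity
  have hM2 : relativeMass ρbar (ρ t) ≤ (ρmax - ρbar) * (4 * Real.pi / 3 * (R + σ * t) ^ 3) := by
    refine ((hMle t ht').trans hM1).trans (mul_le_mul_of_nonneg_left ?_ (sub_nonneg.2 hρmax))
    gcongr
    linarith
  -- the choice of `λ` that maximizes `2 λ F - λ² I`
  have hvir := virial_lower_bound
    (l := radialMomentum (ρ t) (v t) / (4 * Real.pi / 3 * ρmax * (R + σ * t) ^ 5))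
    hA hγ hρbar hr.le (h.density_pos t ht') (fun x hx => (hprop ht' hx).1)
    (fun x hx => (hprop ht' hx).2.1) (hM.trans (hMge t ht')) hM2 (hGnn t ht') hi
    (h.c1Slab_density_sub.integrable_slice hK hM0 ht')
    (h.c1Slab_radialMomentum.integrable_slice hK hF0 ht')
    (h.c1Slab_trace.integrable_slice hK hG0 ht')
  have hval : 4 * Real.pi / 3 * ρmax * (R + σ * t) ^ 5
      * (2 * (radialMomentum (ρ t) (v t) / (4 * Real.pi / 3 * ρmax * (R + σ * t) ^ 5))
          * radialMomentum (ρ t) (v t)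
        - (radialMomentum (ρ t) (v t) / (4 * Real.pi / 3 * ρmax * (R + σ * t) ^ 5)) ^ 2
          * (4 * Real.pi / 3 * ρmax * (R + σ * t) ^ 5)) = radialMomentum (ρ t) (v t) ^ 2 := by
    field_simp
    ring
  rw [← hval]
  exact mul_le_mul_of_nonneg_left hvir hI.le

end ShearBulkFluid

theorem theorem3 (A γ τ ζ : ℝ) (hA : 0 < A) (hγ : 1 < γ) (hτ : 0 < τ) (hζ : 0 < ζ)
    (η : ℝ → ShearBulkFluid.Tensor → ℝ)
    (hη : ContDiffOn ℝ 1 (fun p : ℝ × ShearBulkFluid.Tensor => η p.1 p.2) (Ioi 0 ×ˢ univ))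
    (ρbar R : ℝ) (hρbar : 0 < ρbar) (hR : 0 < R)
    (hηbar : 0 < η ρbar 0)
    (T : ℝ) (hT : 0 < T)
    (ρ : ℝ → ShearBulkFluid.Space → ℝ)
    (v : ℝ → ShearBulkFluid.Space → ShearBulkFluid.Space)
    (S : ℝ → ShearBulkFluid.Space → ShearBulkFluid.Tensor)
    (hsol : ShearBulkFluid.IsC1Solution A γ τ ζ η T ρ v S)
    (hρ_out : ∀ x, R ≤ ‖x‖ → ρ 0 x = ρbar)
    (hv_out : ∀ x, R ≤ ‖x‖ → v 0 x = 0)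
    (hS_out : ∀ x, R ≤ ‖x‖ → S 0 x = 0)
    (ρmax : ℝ) (hρmax : IsGreatest (range (ρ 0)) ρmax)
    (hM : 0 ≤ ShearBulkFluid.relativeMass ρbar (ρ 0))
    (hF : 16 * Real.pi / 3 * ShearBulkFluid.frontSpeed A γ τ ζ η ρbar * R ^ 4 * ρmax
      < ShearBulkFluid.radialMomentum (ρ 0) (v 0))
    (hG : 0 ≤ ShearBulkFluid.totalTrace (S 0)) :
    ShearBulkFluid.lifespan A γ τ ζ η (ρ 0) (v 0) (S 0) < ⊤ := by
  have hF' : 4 * (4 * Real.pi / 3 * ρmax) * ShearBulkFluid.frontSpeed A γ τ ζ η ρbar * R ^ 4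
      < ShearBulkFluid.radialMomentum (ρ 0) (v 0) := by linarith
  refine lt_of_le_of_lt (sSup_le ?_) (ENNReal.ofReal_lt_top (r := 1 / (4 * R ^ 3
    * ShearBulkFluid.frontSpeed A γ τ ζ η ρbar * (1 / R ^ 4 - 4 * (4 * Real.pi / 3 * ρmax)
      * ShearBulkFluid.frontSpeed A γ τ ζ η ρbar / ShearBulkFluid.radialMomentum (ρ 0) (v 0)))))
  rintro _ ⟨T', hT', rfl, ρ', v', S', hsol', hρ', hv', hS'⟩
  have h := hsol'.time_le hT' hA hγ hτ hζ hη hρbar hR hηbar (by rwa [hρ']) (by rwa [hv'])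
    (by rwa [hS']) (fun x => by rw [hρ']; exact hρmax.2 (mem_range_self x)) (by rwa [hρ'])
    (by rwa [hρ', hv']) (by rwa [hS'])
  rw [hρ', hv'] at h
  exact ENNReal.ofReal_le_ofReal h
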